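/- Let $X$ be a proper geodesic $\mathrm{CAT}(-1)$ metric space having at least two points. A geodesic ray (line) is an isometric map $[0,+\infty[\,\to X$ ($\mathbb{R}\to X$), and $\partial_\infty X$ is the set of classes of geodesic rays under the relation of staying at bounded distance, with its usual topology (the quotient of the compact-open topology). Assume that $\partial_\infty X$ is arcwise connected and that $X$ has extendible geodesics, that is, every geodesic segment of $X$ can be extended to a geodesic line. For $\xi\in\partial_\infty X$ and $x,y\in X$ let $\beta_\xi(x,y)=\lim_{t\to+\infty}\big(d(x,\rho(t))-d(y,\rho(t))\big)$, where $\rho$ is any geodesic ray ending at $\xi$. A horoball with point at infinity $\xi$ is a set $H=\{y\in X:\beta_\xi(x,y)\ge s\}$ with $x\in X$ and $s\in\mathbb{R}$, and for $t\ge 0$ its shrunk horoball is $H[t]=\{y\in X:\beta_\xi(x,y)\ge s+t\}$. If $H$ is the closed ball of center $c$ and radius $r\ge 0$, then $H[t]$ is the closed ball of center $c$ and radius $r-t$ if $0\le t\le r$, and $H[t]=\emptyset$ if $t>r$. Let $(H_\alpha)_{\alpha\in\mathcal{A}}$ be any family of balls or horoballs in $X$ with pairwise disjoint interiors, and let $\mu_0=1.534$.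 (1) For every $x\in X-\bigcup_{\alpha\in\mathcal{A}}H_\alpha$ there exists a geodesic ray starting from $x$ that does not meet $H_\alpha[\mu_0]$ for any $\alpha\in\mathcal{A}$. (2) For every $\alpha_0\in\mathcal{A}$ such that $H_{\alpha_0}$ is a horoball, there exists a geodesic line $\gamma$ starting from the point at infinity $\xi$ of $H_{\alpha_0}$ (that is, the ray $t\mapsto\gamma(-t)$ belongs to the class $\xi$) that does not meet $H_\alpha[\mu_0]$ for any $\alpha\in\mathcal{A}$ with $\alpha\ne\alpha_0$. -/

import Mathlib

open scoped NNReal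

/-- `γ` restricted to `I ⊆ ℝ` is an isometric map (a geodesic segment, ray or line when `I` is a
compact interval, a closed half-line or `ℝ`). -/
def IsGeodesicOn {X : Type*} [MetricSpace X] (γ : ℝ → X) (I : Set ℝ) : Prop :=
  ∀ s ∈ I, ∀ t ∈ I, dist (γ s) (γ t) = |s - t|

/-- `γ` is a geodesic segment from `x` to `y`, parametrized by `[0, d(x, y)]`. -/
def IsGeodesicSegment {X : Type*} [MetricSpace X] (γ : ℝ → X) (x y : X) : Prop :=
  γ 0 = x ∧ γ (dist x y) = y ∧ IsGeodesicOn γ (Set.Icc 0 (dist x y))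

/-- A geodesic metric space: any two points are joined by a geodesic segment. -/
def IsGeodesicSpace (X : Type*) [MetricSpace X] : Prop :=
  ∀ x y : X, ∃ γ : ℝ → X, IsGeodesicSegment γ x y

/-- The `CAT(-1)` inequality for all geodesic triangles: if `(x', y', z')` is a comparison triangle
in the real hyperbolic plane of curvature `-1` (the upper half-plane) of a geodesic triangle
`(x, y, z)` of `X`, then two points of the triangle are at most as far apart as their comparison
points. Two different sides of a triangle share a vertex, here called `x`, and on a single side
the inequality is an equality. -/
def SatisfiesCATNegOne (X : Type*) [MetricSpace X] : Prop :=
  ∀ (x y z : X) (x' y' z' : UpperHalfPlane),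
    dist x' y' = dist x y → dist x' z' = dist x z → dist y' z' = dist y z →
    ∀ (σ τ : ℝ → X) (σ' τ' : ℝ → UpperHalfPlane),
      IsGeodesicSegment σ x y → IsGeodesicSegment τ x z →
      IsGeodesicSegment σ' x' y' → IsGeodesicSegment τ' x' z' →
      ∀ s ∈ Set.Icc 0 (dist x y), ∀ t ∈ Set.Icc 0 (dist x z),
        dist (σ s) (τ t) ≤ dist (σ' s) (τ' t)

/-- A geodesic `CAT(-1)` metric space. -/
structure IsCATNegOneSpace (X : Type*) [MetricSpace X] : Prop where
  geodesic : IsGeodesicSpace X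
  comparison : SatisfiesCATNegOne X

/-- Extendible geodesics: every geodesic segment can be extended to a geodesic line. -/
def HasExtendibleGeodesics (X : Type*) [MetricSpace X] : Prop :=
  ∀ (a b : ℝ) (σ : ℝ → X), a ≤ b → IsGeodesicOn σ (Set.Icc a b) →
    ∃ γ : ℝ → X, Isometry γ ∧ Set.EqOn γ σ (Set.Icc a b)

/-- The space of geodesic rays `[0, +∞[ → X`, with the compact-open topology. -/
abbrev GeodesicRay (X : Type*) [MetricSpace X] : Type _ :=
  {ρ : C(ℝ≥0, X) // Isometry ρ}

/-- Two geodesic rays are asymptotic if they stay at bounded distance from each other. -/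
def asymptoticSetoid (X : Type*) [MetricSpace X] : Setoid (GeodesicRay X) where
  r ρ ρ' := ∃ K : ℝ, ∀ t : ℝ≥0, dist (ρ.1 t) (ρ'.1 t) ≤ K
  iseqv :=
    { refl := fun ρ => ⟨0, fun t => (dist_self (ρ.1 t)).le⟩
      symm := fun ⟨K, hK⟩ => ⟨K, fun t => by rw [dist_comm]; exact hK t⟩
      trans := fun ⟨K, hK⟩ ⟨L, hL⟩ =>
        ⟨K + L, fun t => (dist_triangle _ _ _).trans (add_le_add (hK t) (hL t))⟩ }

/-- The boundary at infinity `∂∞X`: the asymptotic classes of geodesic rays. It carries the quotient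
of the compact-open topology; for a proper `CAT(-1)` space this is the usual (cone) topology, that
is, the one making the bijection with the space of rays from any base point a homeomorphism. -/
abbrev BoundaryAtInfinity (X : Type*) [MetricSpace X] : Type _ :=
  Quotient (asymptoticSetoid X)

/-- A geodesic line of `X`. -/
abbrev GeodesicLine (X : Type*) [MetricSpace X] : Type _ :=
  {γ : ℝ → X // Isometry γ}

/-- The geodesic ray `t ↦ γ(-t)`, for `γ` a geodesic line. -/
def GeodesicLine.backwardRay {X : Type*} [MetricSpace X] (γ : GeodesicLine X) : GeodesicRay X :=
  have h : Isometry (fun t : ℝ≥0 => γ.1 (-(t : ℝ))) :=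
    γ.2.comp ((IsometryEquiv.neg ℝ).isometry.comp isometry_subtype_coe)
  ⟨⟨fun t => γ.1 (-(t : ℝ)), h.continuous⟩, h⟩

/-- The starting point `γ(-∞)` of a geodesic line `γ`. -/
def GeodesicLine.start {X : Type*} [MetricSpace X] (γ : GeodesicLine X) : BoundaryAtInfinity X :=
  Quotient.mk (asymptoticSetoid X) (GeodesicLine.backwardRay γ)

/-- The Busemann function `β_ξ(x, y) = lim (d(x, ρ(t)) - d(y, ρ(t)))` as `t → +∞`, where `ρ` is a
geodesic ray ending at `ξ`. The limit always exists, and in a `CAT(-1)` space it does not depend on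
the choice of the ray `ρ`. -/
noncomputable def busemann {X : Type*} [MetricSpace X] (ξ : BoundaryAtInfinity X) (x y : X) : ℝ :=
  Filter.limUnder Filter.atTop (fun t : ℝ≥0 => dist x (ξ.out.1 t) - dist y (ξ.out.1 t))

/-- A ball (given by its center and radius) or a horoball (given by its point at infinity `ξ`, a
point `x` and a level `s`). -/
inductive BallOrHoroball (X : Type*) [MetricSpace X] where
  | ball (c : X) (r : ℝ) (hr : 0 ≤ r) : BallOrHoroball X
  | horoball (ξ : BoundaryAtInfinity X) (x : X) (s : ℝ) : BallOrHoroball X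

/-- The underlying closed subset: the closed ball of center `c` and radius `r`, or the closed
horoball `{y | β_ξ(x, y) ≥ s}`. -/
def BallOrHoroball.carrier {X : Type*} [MetricSpace X] : BallOrHoroball X → Set X
  | .ball c r _ => Metric.closedBall c r
  | .horoball ξ x s => {y | s ≤ busemann ξ x y}

/-- The shrunk set `H[t]` for `t ≥ 0`: the closed ball of radius `r - t` (which is empty for
`t > r`), or the closed horoball `{y | β_ξ(x, y) ≥ s + t}`. -/
def BallOrHoroball.shrink {X : Type*} [MetricSpace X] : BallOrHoroball X → ℝ → Set X
  | .ball c r _, t => Metric.closedBall c (r - t)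
  | .horoball ξ x s, t => {y | s + t ≤ busemann ξ x y}

/-! The proof turns the problem into one about obstacles on a path at infinity. The metric input is
the Ptolemaic inequality for `exp (dist / 2)` (`IsCATNegOneSpace.expPtolemaic`), proved in the
half-plane and carried over to `X` by gluing comparison triangles. It makes `exp (-(a|b)_o)`, with
`(a|b)_o` the Gromov product, satisfy the triangle inequality without any constant, also when one
point is at infinity, and it makes Busemann functions continuous in the point at infinity.

Fix a base point `o`. A ball of center `c` and radius `r` has visual size `δ = exp (r - d(o, c))`. A
ray from `o` that enters the ball shrunk by `1.52` ends at visual distance less than `0.23 δ` from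
`c`, and horoballs can be replaced by large balls (`ExpPtolemaic.exists_ball_representative`).
Disjointness of two balls means that their centers are at visual distance at least `√δ √δ'`: around
a large obstacle only much smaller ones can be found. A path at infinity whose ends are visually far
apart therefore has a point outside all the obstacles, by a nested interval argument
(`exists_avoiding_of_separated`).

For (1), the path joins the two ends of a line through `x`. For (2), base points go to infinity
along a ray `ζ` towards `ξ`, while one fixed path, away from `ξ`, is used for all of them. The
resulting rays pass at bounded distance from `ζ 0` and converge to a line; the margin `1.534 - 1.52`
absorbs the passage to the limit. -/

/-! ### Triangle comparison in hyperboloid coordinates. -/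

/-- The point of the upper half-plane with hyperboloid coordinates `(√(1 + w² + y²), w, y)`. -/
noncomputable def hyperboloidPoint (w y : ℝ) : UpperHalfPlane :=
  ⟨⟨y / (√(1 + w ^ 2 + y ^ 2) - w), 1 / (√(1 + w ^ 2 + y ^ 2) - w)⟩, by
    have : w < √(1 + w ^ 2 + y ^ 2) := Real.lt_sqrt_of_sq_lt (by nlinarith [sq_nonneg y])
    exact one_div_pos.2 (sub_pos.2 this)⟩

theorem cosh_dist_hyperboloidPoint (w y w' y' : ℝ) :
    Real.cosh (dist (hyperboloidPoint w y) (hyperboloidPoint w' y')) =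
      √(1 + w ^ 2 + y ^ 2) * √(1 + w' ^ 2 + y' ^ 2) - w * w' - y * y' := by
  have h : w < √(1 + w ^ 2 + y ^ 2) := Real.lt_sqrt_of_sq_lt (by nlinarith [sq_nonneg y])
  have h' : w' < √(1 + w' ^ 2 + y' ^ 2) := Real.lt_sqrt_of_sq_lt (by nlinarith [sq_nonneg y'])
  have e : √(1 + w ^ 2 + y ^ 2) ^ 2 = 1 + w ^ 2 + y ^ 2 := Real.sq_sqrt (by positivity)
  have e' : √(1 + w' ^ 2 + y' ^ 2) ^ 2 = 1 + w' ^ 2 + y' ^ 2 := Real.sq_sqrt (by positivity)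
  rw [UpperHalfPlane.cosh_dist, Complex.dist_eq, Complex.sq_norm, Complex.normSq_apply]
  simp only [hyperboloidPoint, UpperHalfPlane.im, Complex.sub_re, Complex.sub_im]
  set C := √(1 + w ^ 2 + y ^ 2)
  set C' := √(1 + w' ^ 2 + y' ^ 2)
  have hC : C - w ≠ 0 := by linarith
  have hC' : C' - w' ≠ 0 := by linarith
  field_simp
  have e2 : y ^ 2 = C ^ 2 - 1 - w ^ 2 := by linarith
  have e2' : y' ^ 2 = C' ^ 2 - 1 - w' ^ 2 := by linarith
  ring_nf
  rw [e2, e2']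
  ring

theorem dist_eq_of_cosh {Y : Type*} [PseudoMetricSpace Y] {a b : Y} {t : ℝ}
    (h : Real.cosh (dist a b) = Real.cosh t) : dist a b = |t| := by
  have := le_antisymm (Real.cosh_le_cosh.1 h.le) (Real.cosh_le_cosh.1 h.ge)
  rwa [abs_of_nonneg dist_nonneg] at this

theorem dist_hyperboloidPoint_ray {k l : ℝ} (h : k ^ 2 + l ^ 2 = 1) (s t : ℝ) :
    dist (hyperboloidPoint (Real.sinh s * k) (Real.sinh s * l))
      (hyperboloidPoint (Real.sinh t * k) (Real.sinh t * l)) = |s - t| := by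
  have key : ∀ r : ℝ, √(1 + (Real.sinh r * k) ^ 2 + (Real.sinh r * l) ^ 2) = Real.cosh r := by
    intro r
    rw [show 1 + (Real.sinh r * k) ^ 2 + (Real.sinh r * l) ^ 2 = Real.cosh r ^ 2 by
      rw [Real.cosh_sq]; linear_combination Real.sinh r ^ 2 * h]
    exact Real.sqrt_sq (Real.cosh_pos r).le
  apply dist_eq_of_cosh
  rw [cosh_dist_hyperboloidPoint, key, key, Real.cosh_sub]
  linear_combination (-Real.sinh s * Real.sinh t) * h

/-- In a triangle with sides `p, L, r` the Lorentzian coordinate `w` of the third vertex. -/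
theorem sq_le_sinh_sq_of_triangle {p L r w : ℝ} (hL : 0 < L)
    (h1 : r ≤ p + L) (h2 : p ≤ r + L) (h3 : L ≤ p + r)
    (hw : w * Real.sinh L = Real.cosh p * Real.cosh L - Real.cosh r) :
    w ^ 2 ≤ Real.sinh p ^ 2 := by
  have hp : 0 ≤ p := by linarith
  have hr : 0 ≤ r := by linarith
  have hS : 0 < Real.sinh L := Real.sinh_pos_iff.2 hL
  have a1 : Real.cosh r ≤ Real.cosh (p + L) := Real.cosh_le_cosh.2 (by
    rw [abs_of_nonneg hr, abs_of_nonneg (by linarith)]; exact h1)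
  have a2 : Real.cosh (p - L) ≤ Real.cosh r := Real.cosh_le_cosh.2 (by
    rw [abs_of_nonneg hr, abs_le]; constructor <;> linarith)
  rw [Real.cosh_add] at a1
  rw [Real.cosh_sub] at a2
  refine sq_le_sq' ?_ ?_
  · refine le_of_mul_le_mul_right ?_ hS
    linarith
  · refine le_of_mul_le_mul_right ?_ hS
    linarith

/-- The `CAT(-1)` inequality between a vertex and the opposite side, in hyperboloid coordinates. -/
theorem IsCATNegOneSpace.cosh_dist_segment_le {X : Type*} [MetricSpace X] (hX : IsCATNegOneSpace X)
    {a c x : X} (hac : a ≠ c) {σ : ℝ → X} (hσ : IsGeodesicSegment σ a c) {w : ℝ}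
    (hw : w * Real.sinh (dist a c) =
      Real.cosh (dist a x) * Real.cosh (dist a c) - Real.cosh (dist x c))
    {s : ℝ} (hs : s ∈ Set.Icc 0 (dist a c)) :
    Real.cosh (dist x (σ s)) ≤ Real.cosh (dist a x) * Real.cosh s - w * Real.sinh s := by
  have hL : 0 < dist a c := dist_pos.2 hac
  have hsq := sq_le_sinh_sq_of_triangle hL (by linarith [dist_triangle x a c, dist_comm a x])
    (by linarith [dist_triangle a c x, dist_comm x c]) (dist_triangle a x c) hw
  obtain ⟨τ, hτ⟩ := hX.geodesic a x
  set p := dist a x with hp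
  -- `(k, l)` is the cosine and sine of the comparison angle at `a`, so that `τ'` leaves `σ' 0` at
  -- this angle; when `x = a` the direction is arbitrary.
  obtain ⟨k, l, hkl, hk⟩ : ∃ k l : ℝ, k ^ 2 + l ^ 2 = 1 ∧ Real.sinh p * k = w := by
    by_cases h0 : Real.sinh p = 0
    · refine ⟨1, 0, by norm_num, ?_⟩
      rw [h0] at hsq ⊢
      nlinarith
    · refine ⟨w / Real.sinh p, √(1 - (w / Real.sinh p) ^ 2), ?_, by field_simp⟩
      rw [Real.sq_sqrt]; · ring
      rw [div_pow, sub_nonneg, div_le_one (by positivity)]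
      exact hsq
  set σ' : ℝ → UpperHalfPlane := fun t => hyperboloidPoint (Real.sinh t * 1) (Real.sinh t * 0)
  set τ' : ℝ → UpperHalfPlane := fun t => hyperboloidPoint (Real.sinh t * k) (Real.sinh t * l)
  have e0 : σ' 0 = τ' 0 := by simp [σ', τ']
  have dσ : ∀ s t, dist (σ' s) (σ' t) = |s - t| :=
    fun s t => dist_hyperboloidPoint_ray (by norm_num) s t
  have dτ : ∀ s t, dist (τ' s) (τ' t) = |s - t| := fun s t => dist_hyperboloidPoint_ray hkl s t
  have cd : ∀ s, Real.cosh (dist (σ' s) (τ' p)) = Real.cosh p * Real.cosh s - w * Real.sinh s := by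
    intro s
    have key : ∀ r k l : ℝ, k ^ 2 + l ^ 2 = 1 →
        √(1 + (Real.sinh r * k) ^ 2 + (Real.sinh r * l) ^ 2) = Real.cosh r := by
      intro r k l h
      rw [show 1 + (Real.sinh r * k) ^ 2 + (Real.sinh r * l) ^ 2 = Real.cosh r ^ 2 by
        rw [Real.cosh_sq]; linear_combination Real.sinh r ^ 2 * h]
      exact Real.sqrt_sq (Real.cosh_pos r).le
    rw [cosh_dist_hyperboloidPoint, key _ _ _ hkl, key _ _ _ (by norm_num), ← hk]
    ring
  have hp0 : 0 ≤ p := dist_nonneg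
  have d1 : dist (σ' 0) (σ' (dist a c)) = dist a c := by rw [dσ]; simp
  have d2 : dist (σ' 0) (τ' p) = p := by rw [e0, dτ]; simp [abs_of_nonneg hp0]
  have d3 : dist (σ' (dist a c)) (τ' p) = dist c x := by
    rw [← abs_of_nonneg (dist_nonneg (x := c) (y := x))]
    apply dist_eq_of_cosh
    rw [cd, hw, dist_comm c x]; ring
  have := hX.comparison a c x (σ' 0) (σ' (dist a c)) (τ' p) d1 d2 d3 σ τ σ' τ' hσ hτ
    ⟨rfl, by rw [d1], fun s _ t _ => dσ s t⟩
    ⟨e0.symm, by rw [d2], fun s _ t _ => dτ s t⟩ s hs p ⟨hp0, le_rfl⟩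
  rw [hτ.2.1] at this
  rw [← cd, dist_comm x]
  exact Real.cosh_le_cosh.2 (by rwa [abs_of_nonneg dist_nonneg, abs_of_nonneg dist_nonneg])

/-! ### The Ptolemaic inequality in the upper half-plane. -/

theorem Complex.dist_mul_dist_le (a b c x : ℂ) :
    dist a c * dist x b ≤ dist a b * dist x c + dist b c * dist x a := by
  simp only [Complex.dist_eq, ← norm_mul]
  calc ‖(a - c) * (x - b)‖ = ‖(a - b) * (x - c) + (b - c) * (x - a)‖ := by congr 1; ring
    _ ≤ _ := norm_add_le _ _

theorem UpperHalfPlane.dist_coe_le_dist_conj (z w : UpperHalfPlane) :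
    dist (z : ℂ) w ≤ dist (z : ℂ) ((starRingEnd ℂ) (w : ℂ)) := by
  rw [Complex.dist_eq, Complex.dist_eq]
  refine abs_le_of_sq_le_sq' ?_ (norm_nonneg _) |>.2
  rw [Complex.sq_norm, Complex.sq_norm, Complex.normSq_apply, Complex.normSq_apply]
  have := mul_pos z.im_pos w.im_pos
  simp only [Complex.sub_re, Complex.sub_im, Complex.conj_re, Complex.conj_im,
    UpperHalfPlane.coe_im, UpperHalfPlane.coe_re]
  nlinarith

/-- Since `exp (d(z, w) / 2)` is `|z - w| + |z - conj w|` over `2 √(im z * im w)`, the inequality is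
the sum of four Euclidean Ptolemy inequalities, in which `b` and `c` are conjugated or not. The sum
has `2 |x - a|` where `|x - a| + |x - conj a|` is wanted, and `|x - a| ≤ |x - conj a|`. -/
theorem UpperHalfPlane.exp_half_dist_mul_le (a b c x : UpperHalfPlane) :
    Real.exp (dist a c / 2) * Real.exp (dist x b / 2) ≤
      Real.exp (dist a b / 2) * Real.exp (dist x c / 2) +
        Real.exp (dist b c / 2) * Real.exp (dist x a / 2) := by
  have conj_dist : ∀ z w : ℂ, dist ((starRingEnd ℂ) z) w = dist z ((starRingEnd ℂ) w) := by
    intro z w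
    rw [Complex.dist_eq, Complex.dist_eq, ← Complex.norm_conj, map_sub, Complex.conj_conj]
  simp only [UpperHalfPlane.exp_half_dist, Real.sqrt_mul a.im_pos.le, Real.sqrt_mul b.im_pos.le,
    Real.sqrt_mul x.im_pos.le]
  have h1 := Complex.dist_mul_dist_le a b c x
  have h2 := Complex.dist_mul_dist_le a ((starRingEnd ℂ) b) c x
  have h3 := Complex.dist_mul_dist_le a b ((starRingEnd ℂ) c) x
  have h4 := Complex.dist_mul_dist_le a ((starRingEnd ℂ) b) ((starRingEnd ℂ) c) x
  rw [conj_dist] at h2 h4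
  rw [Complex.conj_conj] at h4
  have hxa := UpperHalfPlane.dist_coe_le_dist_conj x a
  have hbc : 0 ≤ dist (b : ℂ) c + dist (b : ℂ) ((starRingEnd ℂ) (c : ℂ)) := by positivity
  have h5 := mul_le_mul_of_nonneg_left hxa hbc
  have pa := Real.sqrt_pos.2 a.im_pos
  have pb := Real.sqrt_pos.2 b.im_pos
  have pc := Real.sqrt_pos.2 c.im_pos
  have px := Real.sqrt_pos.2 x.im_pos
  rw [div_mul_div_comm, div_mul_div_comm, div_mul_div_comm, ← sub_nonneg]
  have key : ∀ N M K a b c x : ℝ, 0 < a → 0 < b → 0 < c → 0 < x → N ≤ M + K →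
      0 ≤ M / (2 * (a * b) * (2 * (x * c))) + K / (2 * (b * c) * (2 * (x * a))) -
        N / (2 * (a * c) * (2 * (x * b))) := by
    intro N M K a b c x ha hb hc hx h
    have : M / (2 * (a * b) * (2 * (x * c))) + K / (2 * (b * c) * (2 * (x * a))) -
        N / (2 * (a * c) * (2 * (x * b))) = (M + K - N) / (4 * a * b * c * x) := by
      field_simp
      ring
    rw [this]
    exact div_nonneg (by linarith) (by positivity)
  refine key _ _ _ _ _ _ _ pa pb pc px ?_
  linarith

/-! ### Transfer of the Ptolemaic inequality to `CAT(-1)` spaces. -/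

/-- The Ptolemaic inequality for `exp (dist / 2)`. -/
def ExpPtolemaic (X : Type*) [MetricSpace X] : Prop :=
  ∀ a b c x : X, Real.exp (dist a c / 2) * Real.exp (dist x b / 2) ≤
    Real.exp (dist a b / 2) * Real.exp (dist x c / 2) +
      Real.exp (dist b c / 2) * Real.exp (dist x a / 2)

/-- In a hyperbolic triangle, `exp (-2 (Gromov product))` at a vertex of angle `θ` is at least
`(1 - cos θ) / 2 = sin² (θ / 2)`. -/
theorem exp_gromov_sq_ge {p L r w : ℝ} (hL : 0 < L) (hp : 0 < p) (h1 : r ≤ p + L)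
    (h2 : |p - L| ≤ r) (hw : w * Real.sinh L = Real.cosh p * Real.cosh L - Real.cosh r) :
    (1 - w / Real.sinh p) / 2 ≤ Real.exp (r - p - L) := by
  have hS : 0 < Real.sinh L := Real.sinh_pos_iff.2 hL
  have hP : 0 < Real.sinh p := Real.sinh_pos_iff.2 hp
  have e : (1 - w / Real.sinh p) / 2 =
      (Real.cosh r - Real.cosh (p - L)) / (Real.cosh (p + L) - Real.cosh (p - L)) := by
    have : Real.cosh (p + L) - Real.cosh (p - L) = 2 * Real.sinh p * Real.sinh L := by
      rw [Real.cosh_add, Real.cosh_sub]; ring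
    rw [this, Real.cosh_sub]
    field_simp
    linear_combination -hw
  have hpos : 0 < Real.cosh (p + L) - Real.cosh (p - L) := by
    rw [Real.cosh_add, Real.cosh_sub]; nlinarith [mul_pos hP hS]
  rw [e, div_le_iff₀ hpos]
  set D := Real.cosh (p - L)
  have hD : 1 ≤ D := Real.one_le_cosh _
  have hr : 0 ≤ r := (abs_nonneg _).trans h2
  rw [Real.cosh_eq, Real.cosh_eq]
  set u := Real.exp (-r) with hu
  set v := Real.exp (-(p + L)) with hv
  have hu0 : 0 < u := Real.exp_pos _
  have hv0 : 0 < v := Real.exp_pos _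
  have huv : v ≤ u := Real.exp_le_exp.2 (by linarith)
  have hu1 : u ≤ 1 := Real.exp_le_one_iff.2 (by linarith)
  have er : Real.exp r = u⁻¹ := by rw [hu, Real.exp_neg, inv_inv]
  have es : Real.exp (p + L) = v⁻¹ := by rw [hv, Real.exp_neg, inv_inv]
  have ed : Real.exp (r - p - L) = v / u := by
    rw [show r - p - L = -(p + L) + r by ring, Real.exp_add, er]; rfl
  rw [er, es, ed, ← sub_nonneg]
  have : v / u * ((v⁻¹ + v) / 2 - D) - ((u⁻¹ + u) / 2 - D) =
      (u - v) * (2 * D - (u + v)) / (2 * u) := by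
    field_simp
    ring
  rw [this]
  exact div_nonneg (mul_nonneg (by linarith) (by linarith)) (by linarith)

/-- With cosines `c`, `c'` and sines `d`, `d'` of angles in `[0, π]`, the cross term is the sine of
the sum of the angles: if it is negative, the sum exceeds `π` and the cosines add up to at most
zero. -/
theorem add_nonpos_of_cross_neg {c c' d d' : ℝ} (hd : 0 ≤ d) (hd' : 0 ≤ d')
    (hcd : c ^ 2 + d ^ 2 = 1) (hcd' : c' ^ 2 + d' ^ 2 = 1) (hn : d' * c + d * c' < 0) :
    c + c' ≤ 0 := by
  by_contra! hcon
  rcases le_total c c' with h | h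
  · have h1 : 0 ≤ (c' - c) * (c' + c) := mul_nonneg (by linarith) (by linarith)
    have h3 : d' ≤ d := abs_le_of_sq_le_sq' (by linarith) hd |>.2
    have h4 : 0 ≤ (d - d') * c' := mul_nonneg (by linarith) (by linarith)
    have h5 : 0 ≤ d' * (c + c') := mul_nonneg hd' hcon.le
    linarith
  · have h1 : 0 ≤ (c - c') * (c' + c) := mul_nonneg (by linarith) (by linarith)
    have h3 : d ≤ d' := abs_le_of_sq_le_sq' (by linarith) hd' |>.2
    have h4 : 0 ≤ (d' - d) * c := mul_nonneg (by linarith) (by linarith)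
    have h5 : 0 ≤ d * (c + c') := mul_nonneg hd hcon.le
    linarith

/-- If the angles of two triangles at a common vertex add up to more than `π`, then the exponentials
of the two Gromov products at this vertex add up to at least one. -/
theorem one_le_exp_gromov_add {p p' L r r' w w' y y' : ℝ} (hL : 0 < L) (hp : 0 ≤ p) (hp' : 0 ≤ p')
    (h1 : r ≤ p + L) (h2 : |p - L| ≤ r) (h1' : r' ≤ p' + L) (h2' : |p' - L| ≤ r')
    (hw : w * Real.sinh L = Real.cosh p * Real.cosh L - Real.cosh r)
    (hw' : w' * Real.sinh L = Real.cosh p' * Real.cosh L - Real.cosh r')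
    (hy : 0 ≤ y) (hy' : 0 ≤ y') (hyw : w ^ 2 + y ^ 2 = Real.sinh p ^ 2)
    (hyw' : w' ^ 2 + y' ^ 2 = Real.sinh p' ^ 2) (hneg : y' * w + y * w' < 0) :
    1 ≤ Real.exp ((r - p - L) / 2) + Real.exp ((r' - p' - L) / 2) := by
  have hS0 : 0 ≤ Real.sinh p := Real.sinh_nonneg_iff.2 hp
  have hS0' : 0 ≤ Real.sinh p' := Real.sinh_nonneg_iff.2 hp'
  have hpp : 0 < p := by
    rcases hp.eq_or_lt with h | h
    · rw [← h, Real.sinh_zero] at hyw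
      have hw0 : w = 0 := by nlinarith [sq_nonneg y, sq_nonneg w]
      have hy0 : y = 0 := by nlinarith [sq_nonneg y, sq_nonneg w]
      rw [hw0, hy0] at hneg
      simp at hneg
    · exact h
  have hpp' : 0 < p' := by
    rcases hp'.eq_or_lt with h | h
    · rw [← h, Real.sinh_zero] at hyw'
      have hw0 : w' = 0 := by nlinarith [sq_nonneg y', sq_nonneg w']
      have hy0 : y' = 0 := by nlinarith [sq_nonneg y', sq_nonneg w']
      rw [hw0, hy0] at hneg
      simp at hneg
    · exact h
  have hP : 0 < Real.sinh p := Real.sinh_pos_iff.2 hpp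
  have hP' : 0 < Real.sinh p' := Real.sinh_pos_iff.2 hpp'
  have g := exp_gromov_sq_ge hL hpp h1 h2 hw
  have g' := exp_gromov_sq_ge hL hpp' h1' h2' hw'
  set c := w / Real.sinh p with hc
  set c' := w' / Real.sinh p' with hc'
  have hcd : c ^ 2 + (y / Real.sinh p) ^ 2 = 1 := by
    rw [hc, div_pow, div_pow, ← add_div, hyw, div_self (by positivity)]
  have hcd' : c' ^ 2 + (y' / Real.sinh p') ^ 2 = 1 := by
    rw [hc', div_pow, div_pow, ← add_div, hyw', div_self (by positivity)]
  have hn : y' / Real.sinh p' * c + y / Real.sinh p * c' < 0 := by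
    rw [hc, hc', div_mul_div_comm, div_mul_div_comm, mul_comm (Real.sinh p'), ← add_div]
    exact div_neg_of_neg_of_pos hneg (mul_pos hP hP')
  have hsum := add_nonpos_of_cross_neg (div_nonneg hy hS0) (div_nonneg hy' hS0') hcd hcd' hn
  have s : Real.exp ((r - p - L) / 2) ^ 2 = Real.exp (r - p - L) := by
    rw [← Real.exp_nat_mul]; congr 1; push_cast; ring
  have s' : Real.exp ((r' - p' - L) / 2) ^ 2 = Real.exp (r' - p' - L) := by
    rw [← Real.exp_nat_mul]; congr 1; push_cast; ring
  have t : Real.exp ((r - p - L) / 2) ≤ 1 := Real.exp_le_one_iff.2 (by linarith)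
  have t' : Real.exp ((r' - p' - L) / 2) ≤ 1 := Real.exp_le_one_iff.2 (by linarith)
  -- Both exponentials are at most one, hence at least their squares, whose sum is bounded below by
  -- `exp_gromov_sq_ge`.
  have q := mul_le_of_le_one_right (Real.exp_pos ((r - p - L) / 2)).le t
  have q' := mul_le_of_le_one_right (Real.exp_pos ((r' - p' - L) / 2)).le t'
  rw [← sq, s] at q
  rw [← sq, s'] at q'
  linarith

/-- In the hyperboloid model, `l` is the Lorentzian norm of the combination, with weights `α` and
`β`, of two points at distance `D`; normalized, it is a point of the segment between them. `A` and
`B` are at most its distances to the two ends, which add up to `D`. -/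
theorem add_le_of_cosh_le {A B D α β l : ℝ} (hA : 0 ≤ A) (hB : 0 ≤ B) (hD : 0 ≤ D) (hα : 0 ≤ α)
    (hβ : 0 ≤ β) (hl : 0 < l) (hl2 : l ^ 2 = α ^ 2 + β ^ 2 + 2 * α * β * Real.cosh D)
    (h1 : Real.cosh A * l ≤ α + β * Real.cosh D) (h2 : Real.cosh B * l ≤ β + α * Real.cosh D) :
    A + B ≤ D := by
  have a0 : 0 ≤ Real.sinh A := Real.sinh_nonneg_iff.2 hA
  have b0 : 0 ≤ Real.sinh B := Real.sinh_nonneg_iff.2 hB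
  have d0 : 0 ≤ Real.sinh D := Real.sinh_nonneg_iff.2 hD
  have ca := Real.cosh_pos A
  have cb := Real.cosh_pos B
  have cd := Real.cosh_pos D
  have sa := Real.cosh_sq A
  have sb := Real.cosh_sq B
  have sd := Real.cosh_sq D
  have i1 : Real.sinh A * l ≤ β * Real.sinh D := by
    refine abs_le_of_sq_le_sq' ?_ (by positivity) |>.2
    have := mul_self_le_mul_self (by positivity) h1
    nlinarith
  have i2 : Real.sinh B * l ≤ α * Real.sinh D := by
    refine abs_le_of_sq_le_sq' ?_ (by positivity) |>.2
    have := mul_self_le_mul_self (by positivity) h2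
    nlinarith
  have j1 := mul_le_mul h1 h2 (by positivity) (by positivity)
  have j2 := mul_le_mul i1 i2 (by positivity) (by positivity)
  have : Real.cosh (A + B) * l ^ 2 ≤ Real.cosh D * l ^ 2 := by
    rw [Real.cosh_add]
    nlinarith
  have := Real.cosh_le_cosh.1 (le_of_mul_le_mul_right this (by positivity))
  rwa [abs_of_nonneg (by linarith), abs_of_nonneg hD] at this

theorem one_le_exp_gromov_of_collinear {p L r w : ℝ} (hL : 0 < L) (hp : 0 ≤ p) (h1 : r ≤ p + L)
    (h2 : |p - L| ≤ r) (hw : w * Real.sinh L = Real.cosh p * Real.cosh L - Real.cosh r)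
    (hw2 : w ^ 2 = Real.sinh p ^ 2) (hneg : w < 0) : 1 ≤ Real.exp ((r - p - L) / 2) := by
  have hS0 : 0 ≤ Real.sinh p := Real.sinh_nonneg_iff.2 hp
  have e : w = - Real.sinh p := by
    rcases sq_eq_sq_iff_eq_or_eq_neg.1 hw2 with h | h
    · linarith
    · exact h
  have hP : 0 < Real.sinh p := by linarith
  have := exp_gromov_sq_ge hL (Real.sinh_pos_iff.1 hP) h1 h2 hw
  rw [e, neg_div, div_self hP.ne'] at this
  have := Real.one_le_exp_iff.1 (show 1 ≤ Real.exp (r - p - L) by linarith)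
  exact Real.one_le_exp (by linarith)

/-- The non-convex case: the path through `a` is then short enough, so bounding `d(x, b)` by `d(x,
a) + d(a, b)` loses nothing that matters. -/
theorem exp_half_dist_mul_le_of_gromov {X : Type*} [MetricSpace X] {a b c x : X}
    (h : 1 ≤ Real.exp ((dist x c - dist a x - dist a c) / 2) +
      Real.exp ((dist b c - dist a b - dist a c) / 2)) :
    Real.exp (dist a c / 2) * Real.exp (dist x b / 2) ≤
      Real.exp (dist a b / 2) * Real.exp (dist x c / 2) +
        Real.exp (dist b c / 2) * Real.exp (dist x a / 2) := by
  rw [← Real.exp_add, ← Real.exp_add, ← Real.exp_add]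
  calc Real.exp (dist a c / 2 + dist x b / 2)
      ≤ Real.exp ((dist a c + dist a x + dist a b) / 2) :=
        Real.exp_le_exp.2 (by linarith [dist_triangle x a b, dist_comm x a])
    _ ≤ Real.exp ((dist a c + dist a x + dist a b) / 2) *
        (Real.exp ((dist x c - dist a x - dist a c) / 2) +
          Real.exp ((dist b c - dist a b - dist a c) / 2)) :=
        le_mul_of_one_le_right (Real.exp_pos _).le h
    _ = _ := by
        rw [mul_add, ← Real.exp_add, ← Real.exp_add, dist_comm x a]
        congr 2 <;> ring

/-- Gluing two comparison triangles along the side `[a, c]`: if the weighted combination of the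
opposite vertices lies on the side, their distance is bounded by the one in the model. -/
theorem IsCATNegOneSpace.dist_le_of_crossing {X : Type*} [MetricSpace X] (hX : IsCATNegOneSpace X)
    {a b c x : X} (hac : a ≠ c) {w w' y y' α β D : ℝ}
    (hw : w * Real.sinh (dist a c) =
      Real.cosh (dist a x) * Real.cosh (dist a c) - Real.cosh (dist x c))
    (hw' : w' * Real.sinh (dist a c) =
      Real.cosh (dist a b) * Real.cosh (dist a c) - Real.cosh (dist b c))
    (hy : w ^ 2 + y ^ 2 = Real.sinh (dist a x) ^ 2)
    (hy' : w' ^ 2 + y' ^ 2 = Real.sinh (dist a b) ^ 2)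
    (hD0 : 0 ≤ D)
    (hD : Real.cosh D = Real.cosh (dist a x) * Real.cosh (dist a b) - w * w' + y * y')
    (hα : 0 ≤ α) (hβ : 0 ≤ β) (hαβ : 0 < α + β) (hcol : α * y = β * y')
    (hN : 0 ≤ α * w + β * w')
    (hN' : (α * w + β * w') * Real.cosh (dist a c) ≤
      (α * Real.cosh (dist a x) + β * Real.cosh (dist a b)) * Real.sinh (dist a c)) :
    dist x b ≤ D := by
  obtain ⟨σ, hσ⟩ := hX.geodesic a c
  set L := dist a c
  set C := Real.cosh (dist a x)
  set C' := Real.cosh (dist a b)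
  have eC : C ^ 2 = 1 + w ^ 2 + y ^ 2 := by rw [Real.cosh_sq]; linarith
  have eC' : C' ^ 2 = 1 + w' ^ 2 + y' ^ 2 := by rw [Real.cosh_sq]; linarith
  have hD1 : 1 ≤ Real.cosh D := Real.one_le_cosh D
  have hC1 : 1 ≤ C := Real.one_le_cosh _
  have hC1' : 1 ≤ C' := Real.one_le_cosh _
  set N := α * w + β * w' with hNdef
  set S := α * C + β * C' with hSdef
  have hS : 0 ≤ S := by positivity
  have e2 : S ^ 2 - N ^ 2 = α ^ 2 + β ^ 2 + 2 * α * β * Real.cosh D := by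
    rw [hD, hSdef, hNdef]
    linear_combination α ^ 2 * eC + β ^ 2 * eC' + (α * y - β * y') * hcol
  have hpos : 0 < S ^ 2 - N ^ 2 := by
    rw [e2]
    have : 0 ≤ 2 * α * β * (Real.cosh D - 1) :=
      mul_nonneg (by positivity) (by linarith)
    nlinarith [mul_pos hαβ hαβ]
  set l := √(S ^ 2 - N ^ 2)
  have hl : 0 < l := Real.sqrt_pos.2 hpos
  have hl2 : l ^ 2 = S ^ 2 - N ^ 2 := Real.sq_sqrt hpos.le
  -- The weighted sum of the vertices has hyperboloid coordinates proportional to `(S, N, 0)`: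
  -- `hcol` puts it on the geodesic of `[a, c]`, at abscissa `s`. The signs in `hN` and `hN'` keep
  -- it between `a` and `c`.
  set s := Real.arsinh (N / l)
  have hsinh : Real.sinh s = N / l := Real.sinh_arsinh _
  have hcosh : Real.cosh s = S / l := by
    refine (pow_left_inj₀ (Real.cosh_pos s).le (by positivity) two_ne_zero).1 ?_
    rw [Real.cosh_sq, hsinh, div_pow, div_pow, hl2]
    field_simp
    ring
  have hs : s ∈ Set.Icc 0 L := by
    constructor
    · exact Real.sinh_nonneg_iff.1 (by rw [hsinh]; positivity)
    · rw [← sub_nonneg, ← Real.sinh_nonneg_iff, Real.sinh_sub, hsinh, hcosh,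
        ← mul_div_assoc, ← mul_div_assoc, ← sub_div]
      exact div_nonneg (by linarith) hl.le
  have k := hX.cosh_dist_segment_le hac hσ hw hs
  have k' := hX.cosh_dist_segment_le hac hσ hw' hs
  rw [hsinh, hcosh, ← mul_div_assoc, ← mul_div_assoc, ← sub_div, le_div_iff₀ hl] at k k'
  have := add_le_of_cosh_le dist_nonneg dist_nonneg hD0 hα hβ hl (hl2.trans e2)
    (k.trans (le_of_eq ?_)) (k'.trans (le_of_eq ?_))
  · calc dist x b ≤ dist x (σ s) + dist (σ s) b := dist_triangle _ _ _
      _ ≤ D := by rw [dist_comm (σ s) b]; exact this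
  · rw [hD, hSdef, hNdef]
    linear_combination α * eC + y * hcol
  · rw [hD, hSdef, hNdef]
    linear_combination β * eC' - y' * hcol

/-- `CAT(-1)` spaces satisfy the Ptolemaic inequality for `exp (dist / 2)`. -/
theorem IsCATNegOneSpace.expPtolemaic {X : Type*} [MetricSpace X] (hX : IsCATNegOneSpace X) :
    ExpPtolemaic X := by
  intro a b c x
  rcases eq_or_ne a c with rfl | hac
  · rw [dist_self, zero_div, Real.exp_zero, one_mul, ← Real.exp_add, ← Real.exp_add]
    have := Real.exp_pos (dist a b / 2 + dist x a / 2)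
    have h2 : Real.exp (dist x b / 2) ≤ Real.exp (dist b a / 2 + dist x a / 2) :=
      Real.exp_le_exp.2 (by linarith [dist_triangle x a b, dist_comm a b])
    linarith
  have hL : 0 < dist a c := dist_pos.2 hac
  have hSL : 0 < Real.sinh (dist a c) := Real.sinh_pos_iff.2 hL
  have ptol := UpperHalfPlane.exp_half_dist_mul_le
  have tri : ∀ z : X, dist z c ≤ dist a z + dist a c ∧ |dist a z - dist a c| ≤ dist z c := by
    intro z
    refine ⟨by linarith [dist_triangle z a c, dist_comm a z], abs_le.2 ⟨?_, ?_⟩⟩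
    · linarith [dist_triangle a z c]
    · linarith [dist_triangle a c z, dist_comm z c]
  have tri' : ∀ z : X, dist a z ≤ dist z c + dist a c ∧ |dist z c - dist a c| ≤ dist a z := by
    intro z
    refine ⟨by linarith [dist_triangle a c z, dist_comm z c], abs_le.2 ⟨?_, ?_⟩⟩
    · linarith [dist_triangle a z c]
    · linarith [dist_triangle z a c, dist_comm a z]
  have coords : ∀ z : X, ∃ w y : ℝ, 0 ≤ y ∧
      w * Real.sinh (dist a c) =
        Real.cosh (dist a z) * Real.cosh (dist a c) - Real.cosh (dist z c) ∧
      w ^ 2 + y ^ 2 = Real.sinh (dist a z) ^ 2 := by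
    intro z
    have hw : (Real.cosh (dist a z) * Real.cosh (dist a c) - Real.cosh (dist z c)) /
        Real.sinh (dist a c) * Real.sinh (dist a c) =
        Real.cosh (dist a z) * Real.cosh (dist a c) - Real.cosh (dist z c) := by field_simp
    generalize (Real.cosh (dist a z) * Real.cosh (dist a c) - Real.cosh (dist z c)) /
        Real.sinh (dist a c) = w at hw
    refine ⟨w, √(Real.sinh (dist a z) ^ 2 - w ^ 2), Real.sqrt_nonneg _, hw, ?_⟩
    rw [Real.sq_sqrt]
    · ring
    · rw [sub_nonneg]
      exact sq_le_sinh_sq_of_triangle hL (tri z).1 (tri' z).1 (dist_triangle a z c) hw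
  -- Coordinates seen from `c`: the reflection exchanging the comparison points of `a` and `c`
  -- changes `w` and preserves `y`.
  have flip : ∀ (z : X) (w y : ℝ), w * Real.sinh (dist a c) =
        Real.cosh (dist a z) * Real.cosh (dist a c) - Real.cosh (dist z c) →
      w ^ 2 + y ^ 2 = Real.sinh (dist a z) ^ 2 →
      (Real.sinh (dist a c) * Real.cosh (dist a z) - Real.cosh (dist a c) * w) *
          Real.sinh (dist a c) =
        Real.cosh (dist z c) * Real.cosh (dist a c) - Real.cosh (dist a z) ∧
      (Real.sinh (dist a c) * Real.cosh (dist a z) - Real.cosh (dist a c) * w) ^ 2 + y ^ 2 =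
        Real.sinh (dist z c) ^ 2 := by
    intro z w y h1 h2
    have e := Real.cosh_sq (dist a c)
    have e1 := Real.cosh_sq (dist a z)
    have e2 := Real.cosh_sq (dist z c)
    have e3 : Real.cosh (dist z c) = Real.cosh (dist a z) * Real.cosh (dist a c) -
      w * Real.sinh (dist a c) := by linarith
    constructor
    · rw [e3]
      linear_combination (-Real.cosh (dist a z)) * e
    · rw [e3] at e2
      linear_combination h2 + e2 - e1 + (w ^ 2 - Real.cosh (dist a z) ^ 2) * e
  obtain ⟨w, y, hy0, hw, hy⟩ := coords x
  obtain ⟨w', y', hy0', hw', hy'⟩ := coords b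
  obtain ⟨fw, fy⟩ := flip x w y hw hy
  obtain ⟨fw', fy'⟩ := flip b w' y' hw' hy'
  set v := Real.sinh (dist a c) * Real.cosh (dist a x) - Real.cosh (dist a c) * w with hv
  set v' := Real.sinh (dist a c) * Real.cosh (dist a b) - Real.cosh (dist a c) * w' with hv'
  have swap : Real.exp (dist c a / 2) * Real.exp (dist x b / 2) ≤
      Real.exp (dist c b / 2) * Real.exp (dist x a / 2) +
        Real.exp (dist b a / 2) * Real.exp (dist x c / 2) →
      Real.exp (dist a c / 2) * Real.exp (dist x b / 2) ≤
      Real.exp (dist a b / 2) * Real.exp (dist x c / 2) +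
        Real.exp (dist b c / 2) * Real.exp (dist x a / 2) := by
    intro h
    rw [dist_comm c a, dist_comm c b, dist_comm b a] at h
    linarith
  -- The two triangles are glued on opposite sides of `[a, c]`. A negative sign here says that the
  -- angles at `a` add up to more than `π`; the next case is the same at `c`. Otherwise the
  -- diagonals cross and `dist_le_of_crossing` compares with the plane.
  by_cases hN : y' * w + y * w' < 0
  · exact exp_half_dist_mul_le_of_gromov (one_le_exp_gromov_add hL dist_nonneg dist_nonneg
      (tri x).1 (tri x).2 (tri b).1 (tri b).2 hw hw' hy0 hy0' hy hy' hN)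
  by_cases hN' : y' * v + y * v' < 0
  · apply swap
    apply exp_half_dist_mul_le_of_gromov
    have := one_le_exp_gromov_add hL dist_nonneg dist_nonneg
      (tri' x).1 (tri' x).2 (tri' b).1 (tri' b).2 fw fw' hy0 hy0' fy fy' hN'
    rwa [dist_comm x a, dist_comm c x, dist_comm c a, dist_comm b a, dist_comm c b]
  push Not at hN hN'
  have conv : (∃ α β : ℝ, 0 ≤ α ∧ 0 ≤ β ∧ 0 < α + β ∧ α * y = β * y' ∧ 0 ≤ α * w + β * w' ∧
      0 ≤ α * v + β * v') → Real.exp (dist a c / 2) * Real.exp (dist x b / 2) ≤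
      Real.exp (dist a b / 2) * Real.exp (dist x c / 2) +
        Real.exp (dist b c / 2) * Real.exp (dist x a / 2) := by
    rintro ⟨α, β, hα, hβ, hαβ, hcol, h1, h2⟩
    have C : ∀ (z : X) (w y : ℝ), w ^ 2 + y ^ 2 = Real.sinh (dist a z) ^ 2 →
        √(1 + w ^ 2 + y ^ 2) = Real.cosh (dist a z) := by
      intro z w y h
      rw [show 1 + w ^ 2 + y ^ 2 = Real.cosh (dist a z) ^ 2 by rw [Real.cosh_sq]; linarith]
      exact Real.sqrt_sq (Real.cosh_pos _).le
    have Cc : √(1 + Real.sinh (dist a c) ^ 2 + 0 ^ 2) = Real.cosh (dist a c) :=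
      C c _ _ (by ring)
    have Ca : √(1 + (0 : ℝ) ^ 2 + 0 ^ 2) = 1 := by norm_num
    have hyn : w ^ 2 + (-y) ^ 2 = Real.sinh (dist a x) ^ 2 := by linarith [neg_sq y]
    have Cx := C x _ _ hyn
    have Cb := C b _ _ hy'
    set a₀ := hyperboloidPoint 0 0
    set c₀ := hyperboloidPoint (Real.sinh (dist a c)) 0
    set x₀ := hyperboloidPoint w (-y)
    set b₀ := hyperboloidPoint w' y'
    have d : ∀ (u v : UpperHalfPlane) (z z' : X), Real.cosh (dist u v) = Real.cosh (dist z z') →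
        dist u v = dist z z' := fun u v z z' h => by
      rw [dist_eq_of_cosh h, abs_of_nonneg dist_nonneg]
    have dac : dist a₀ c₀ = dist a c := d _ _ _ _ (by
      rw [cosh_dist_hyperboloidPoint, Ca, Cc]; ring)
    have dab : dist a₀ b₀ = dist a b := d _ _ _ _ (by
      rw [cosh_dist_hyperboloidPoint, Ca, Cb]; ring)
    have dxa : dist x₀ a₀ = dist x a := d _ _ _ _ (by
      rw [cosh_dist_hyperboloidPoint, Ca, Cx, dist_comm a x]; ring)
    have dxc : dist x₀ c₀ = dist x c := d _ _ _ _ (by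
      rw [cosh_dist_hyperboloidPoint, Cc, Cx]; linarith)
    have dbc : dist b₀ c₀ = dist b c := d _ _ _ _ (by
      rw [cosh_dist_hyperboloidPoint, Cc, Cb]; linarith)
    have hD : Real.cosh (dist x₀ b₀) =
        Real.cosh (dist a x) * Real.cosh (dist a b) - w * w' + y * y' := by
      rw [cosh_dist_hyperboloidPoint, Cx, Cb]; ring
    have := hX.dist_le_of_crossing hac hw hw' hy hy' dist_nonneg hD hα hβ hαβ hcol h1 (by
      rw [hv, hv'] at h2; linarith)
    have P := ptol a₀ b₀ c₀ x₀
    rw [dac, dab, dxa, dxc, dbc] at P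
    refine le_trans (mul_le_mul_of_nonneg_left (Real.exp_le_exp.2 ?_) (Real.exp_pos _).le) P
    linarith
  -- The weights `y'` and `y` cancel the transverse coordinates. If both vanish, the comparison
  -- points are collinear: `x` lies beyond `a`, beyond `c`, or on the segment, where it serves as
  -- crossing point itself.
  by_cases hyy : 0 < y' + y
  · exact conv ⟨y', y, hy0', hy0, hyy, mul_comm _ _, hN, hN'⟩
  have ey : y = 0 := by linarith
  have ey' : y' = 0 := by linarith
  rw [ey] at hy fy
  by_cases hw0 : w < 0
  · apply exp_half_dist_mul_le_of_gromov
    have := one_le_exp_gromov_of_collinear hL dist_nonneg (tri x).1 (tri x).2 hw (by linarith) hw0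
    linarith [Real.exp_pos ((dist b c - dist a b - dist a c) / 2)]
  by_cases hv0 : v < 0
  · apply swap
    apply exp_half_dist_mul_le_of_gromov
    have := one_le_exp_gromov_of_collinear hL dist_nonneg (tri' x).1 (tri' x).2 fw
      (by linarith) hv0
    rw [dist_comm x a, dist_comm c x, dist_comm c a]
    linarith [Real.exp_pos ((dist b a - dist c b - dist a c) / 2)]
  · exact conv ⟨1, 0, by norm_num, le_rfl, by norm_num, by rw [ey]; ring, by linarith,
      by linarith⟩

/-! ### Separated obstacles on an interval. -/

theorem exists_subinterval_of_le {g : ℝ → ℝ} (hg : Continuous g) {s h K K' : ℝ} (hsh : s ≤ h)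
    (hs : K' ≤ g s) (hh : g h ≤ K) (hK : K < K') :
    ∃ a b, s ≤ a ∧ a ≤ b ∧ b ≤ h ∧ (∀ t ∈ Set.Icc a b, K ≤ g t ∧ g t ≤ K') ∧
      g b ≤ K ∧ K' ≤ g a := by
  -- `b` is the first time at which `g ≤ K`, and `a` the last time before `b` at which `g ≥ K'`.
  obtain ⟨b, hb, hbmin⟩ := (isCompact_Icc.inter_right (isClosed_Iic.preimage hg) :
    IsCompact (Set.Icc s h ∩ g ⁻¹' Set.Iic K)).exists_isLeast ⟨h, ⟨hsh, le_rfl⟩, hh⟩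
  obtain ⟨a, ha, hamax⟩ := (isCompact_Icc.inter_right (isClosed_Ici.preimage hg) :
    IsCompact (Set.Icc s b ∩ g ⁻¹' Set.Ici K')).exists_isGreatest ⟨s, ⟨le_rfl, hb.1.1⟩, hs⟩
  refine ⟨a, b, ha.1.1, ha.1.2, hb.1.2, fun t ht => ⟨?_, ?_⟩, hb.2, ha.2⟩
  · by_contra! hcon
    have e : t = b := le_antisymm ht.2
      (hbmin ⟨⟨ha.1.1.trans ht.1, ht.2.trans hb.1.2⟩, hcon.le⟩)
    subst e
    obtain ⟨r, hr, hr2⟩ := intermediate_value_Icc' ht.1 hg.continuousOn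
      (show K ∈ Set.Icc (g t) (g a) from ⟨hcon.le, hK.le.trans ha.2⟩)
    have : r = t := le_antisymm hr.2
      (hbmin ⟨⟨ha.1.1.trans hr.1, hr.2.trans hb.1.2⟩, hr2.le⟩)
    rw [this] at hr2
    exact hcon.ne hr2
  · by_contra! hcon
    have e : t = a := le_antisymm (hamax ⟨⟨ha.1.1.trans ht.1, ht.2⟩, hcon.le⟩) ht.1
    subst e
    obtain ⟨r, hr, hr2⟩ := intermediate_value_Icc' ht.2 hg.continuousOn
      (show K' ∈ Set.Icc (g b) (g t) from ⟨le_trans hb.2 hK.le, hcon.le⟩)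
    have : r = t := le_antisymm (hamax ⟨⟨ha.1.1.trans hr.1, hr.2⟩, hr2.ge⟩) hr.1
    rw [this] at hr2
    exact hcon.ne' hr2

/-- A continuous function taking values above `K'` and below `K` crosses `[K, K']` on a
subinterval. -/
theorem exists_crossing_subinterval {g : ℝ → ℝ} (hg : Continuous g) {a b s h K K' : ℝ}
    (hs : s ∈ Set.Icc a b) (hh : h ∈ Set.Icc a b) (hsK : K' ≤ g s) (hhK : g h ≤ K) (hK : K < K') :
    ∃ a' b', a ≤ a' ∧ a' ≤ b' ∧ b' ≤ b ∧ (∀ t ∈ Set.Icc a' b', K ≤ g t ∧ g t ≤ K') ∧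
      ∃ u ∈ Set.Icc a' b', ∃ v ∈ Set.Icc a' b', g u ≤ K ∧ K' ≤ g v := by
  rcases le_total s h with hsh | hsh
  · obtain ⟨a', b', h1, h2, h3, h4, h5, h6⟩ := exists_subinterval_of_le hg hsh hsK hhK hK
    exact ⟨a', b', hs.1.trans h1, h2, h3.trans hh.2, h4, b', ⟨h2, le_rfl⟩, a', ⟨le_rfl, h2⟩,
      h5, h6⟩
  · obtain ⟨a', b', h1, h2, h3, h4, h5, h6⟩ := exists_subinterval_of_le (s := -s) (h := -h)
      (hg.comp continuous_neg) (neg_le_neg hsh) (by simpa using hsK) (by simpa using hhK) hK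
    refine ⟨-b', -a', by linarith [hh.1], by linarith, by linarith [hs.2], fun t ht => ?_,
      -b', ⟨le_rfl, by linarith⟩, -a', ⟨by linarith, le_rfl⟩, h5, h6⟩
    have := h4 (-t) ⟨by linarith [ht.2], by linarith [ht.1]⟩
    simpa using this

/-- One step of the nested interval construction: pass to a subinterval on which an almost
largest remaining obstacle is avoided, so that the remaining ones are at most half as large. -/
theorem exists_subinterval_halving {B : Type*} {g : B → ℝ → ℝ} {δ : B → ℝ}
    (hg : ∀ α, Continuous (g α)) (hδ : ∀ α, 0 < δ α)
    (hsep : ∀ α β, α ≠ β → ∀ t, √(δ α) * √(δ β) ≤ g α t + g β t)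
    (hdiam : ∀ α β u v, g α u ≤ g α v + g β u + g β v) {a b m : ℝ} (hab : a ≤ b)
    (hI : ∀ β, (∃ t ∈ Set.Icc a b, g β t < 0.23 * δ β) →
      δ β ≤ m ∧ ∃ s ∈ Set.Icc a b, 0.33 * δ β < g β s) :
    ∃ a' b', a ≤ a' ∧ a' ≤ b' ∧ b' ≤ b ∧ ∀ β, (∃ t ∈ Set.Icc a' b', g β t < 0.23 * δ β) →
      δ β ≤ m / 2 ∧ ∃ s ∈ Set.Icc a' b', 0.33 * δ β < g β s := by
  by_cases hne : ∃ β, ∃ t ∈ Set.Icc a b, g β t < 0.23 * δ β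
  swap
  · push Not at hne
    refine ⟨a, b, le_rfl, hab, le_rfl, fun β ⟨t, ht, h⟩ => ?_⟩
    exact absurd h (not_lt.2 (hne β t ht))
  obtain ⟨α, ⟨t₀, ht₀, hα⟩, hmax⟩ : ∃ α, (∃ t ∈ Set.Icc a b, g α t < 0.23 * δ α) ∧
      ∀ β, (∃ t ∈ Set.Icc a b, g β t < 0.23 * δ β) → δ β ≤ 1.1 * δ α := by
    set S := δ '' {β | ∃ t ∈ Set.Icc a b, g β t < 0.23 * δ β} with hS
    have hbdd : BddAbove S := ⟨m, by rintro _ ⟨β, hβ, rfl⟩; exact (hI β hβ).1⟩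
    obtain ⟨β₀, hβ₀⟩ := hne
    have hpos : 0 < sSup S := (hδ β₀).trans_le (le_csSup hbdd ⟨β₀, hβ₀, rfl⟩)
    -- The supremum of the sizes need not be attained, hence the factor `1.1`.
    obtain ⟨_, ⟨α, hα, rfl⟩, hlt⟩ := exists_lt_of_lt_csSup (s := S) ⟨_, β₀, hβ₀, rfl⟩
      (show sSup S / 1.1 < sSup S by rw [div_lt_iff₀ (by norm_num)]; linarith)
    refine ⟨α, hα, fun β hβ => ?_⟩
    have := le_csSup hbdd ⟨β, hβ, rfl⟩
    rw [div_lt_iff₀ (by norm_num)] at hlt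
    linarith
  obtain ⟨hαm, s, hs, hsα⟩ := hI α ⟨t₀, ht₀, hα⟩
  obtain ⟨a', b', h1, h2, h3, hann, u, hu, v, hv, hu', hv'⟩ :=
    exists_crossing_subinterval (hg α) hs ht₀ hsα.le hα.le (by linarith [hδ α])
  refine ⟨a', b', h1, h2, h3, fun β ⟨t, ht, hβ⟩ => ?_⟩
  have hne : α ≠ β := by
    rintro rfl
    linarith [(hann t ht).1]
  have hβm := hmax β ⟨t, ⟨h1.trans ht.1, ht.2.trans h3⟩, hβ⟩
  have hsepβ := hsep α β hne t
  have hA := Real.sq_sqrt (hδ α).le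
  have hB := Real.sq_sqrt (hδ β).le
  have hA0 := Real.sqrt_pos.2 (hδ α)
  have hB0 := Real.sqrt_pos.2 (hδ β)
  -- With `u = √(δ β / δ α)`, separation gives `u ≤ 0.33 + 0.23 u²`, so `u` lies outside the roots,
  -- about `0.36` and `3.99`; almost maximality of `δ α` excludes large `u`, and `0.1296 = 0.36²`.
  have hsmall : δ β ≤ 0.1296 * δ α := by
    have hann2 := (hann t ht).2
    have hle : √(δ β) ≤ 0.36 * √(δ α) := by
      by_contra! hcon
      have h5 : √(δ β) ≤ 1.1 * √(δ α) := by
        refine abs_le_of_sq_le_sq' ?_ (by positivity) |>.2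
        rw [mul_pow]
        linarith [hδ α]
      have : 0 < (√(δ β) - 0.36 * √(δ α)) * (3.98 * √(δ α) - √(δ β)) :=
        mul_pos (by linarith) (by linarith)
      nlinarith [mul_pos hA0 hB0]
    nlinarith
  refine ⟨by linarith [hδ α], ?_⟩
  -- If the subinterval stayed within `0.33 * δ β` of `β`, then `g α` would vary on it by at most
  -- `0.66 * δ β`, which is less than `0.1 * δ α`; but it varies from `0.23 * δ α` to `0.33 * δ α`.
  by_contra! hcon
  linarith [hcon u hu, hcon v hv, hdiam α β v u, hδ α]

/-- A path cannot be covered by separated obstacles of small relative size. -/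
theorem exists_avoiding_of_separated {B : Type*} {g : B → ℝ → ℝ} {δ : B → ℝ} {D : ℝ}
    (hg : ∀ α, Continuous (g α)) (hδ : ∀ α, 0 < δ α) (hD : ∀ α, δ α ≤ D)
    (hsep : ∀ α β, α ≠ β → ∀ t, √(δ α) * √(δ β) ≤ g α t + g β t)
    (hdiam : ∀ α β u v, g α u ≤ g α v + g β u + g β v)
    (hends : ∀ α, 0.66 * δ α < g α 0 + g α 1) :
    ∃ t ∈ Set.Icc (0 : ℝ) 1, ∀ α, 0.23 * δ α ≤ g α t := by
  rcases isEmpty_or_nonempty B with hB | ⟨⟨β₀⟩⟩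
  · exact ⟨0, ⟨le_rfl, zero_le_one⟩, fun α => hB.elim α⟩
  have hD0 : 0 < D := (hδ β₀).trans_le (hD β₀)
  let P : ℕ → ℝ × ℝ → Prop := fun n p => p.1 ≤ p.2 ∧
    ∀ β, (∃ t ∈ Set.Icc p.1 p.2, g β t < 0.23 * δ β) →
      δ β ≤ D / 2 ^ n ∧ ∃ s ∈ Set.Icc p.1 p.2, 0.33 * δ β < g β s
  have step : ∀ n (p : {p // P n p}), ∃ p' : {p // P (n + 1) p},
      Set.Icc p'.1.1 p'.1.2 ⊆ Set.Icc p.1.1 p.1.2 := by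
    rintro n ⟨p, hp1, hp2⟩
    obtain ⟨a', b', h1, h2, h3, h4⟩ := exists_subinterval_halving hg hδ hsep hdiam hp1
      hp2
    refine ⟨⟨(a', b'), h2, fun β hβ => ?_⟩, Set.Icc_subset_Icc h1 h3⟩
    rw [pow_succ, ← div_div]
    exact h4 β hβ
  choose next hnext using step
  have h0 : P 0 (0, 1) := by
    refine ⟨zero_le_one, fun β _ => ⟨by simpa using hD β, ?_⟩⟩
    by_contra! hcon
    linarith [hends β, hcon 0 ⟨le_rfl, zero_le_one⟩, hcon 1 ⟨zero_le_one, le_rfl⟩]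
  let F : ∀ n, {p // P n p} := fun n => Nat.rec ⟨(0, 1), h0⟩ (fun n p => next n p) n
  obtain ⟨t, ht⟩ := IsCompact.nonempty_iInter_of_sequence_nonempty_isCompact_isClosed
    (fun n => Set.Icc (F n).1.1 (F n).1.2) (fun n => hnext n (F n))
    (fun n => Set.nonempty_Icc.2 (F n).2.1) isCompact_Icc (fun n => isClosed_Icc)
  rw [Set.mem_iInter] at ht
  refine ⟨t, ht 0, fun α => ?_⟩
  -- An obstacle containing `t` meets every interval of the sequence, so its size is at most `D / 2
  -- ^ n` for all `n`.
  by_contra! hcon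
  have hlim : Filter.Tendsto (fun n : ℕ => D / 2 ^ n) Filter.atTop (nhds 0) := by
    simpa [div_eq_mul_inv] using
      (tendsto_pow_atTop_nhds_zero_of_lt_one (r := (1 / 2 : ℝ)) (by norm_num)
        (by norm_num)).const_mul D
  have := ge_of_tendsto' hlim (fun n => ((F n).2.2 α ⟨t, ht n, hcon⟩).1)
  linarith [hδ α]
-- Geodesic rays and Busemann functions.
open Filter Topology

section Rays

variable {X : Type*} [MetricSpace X]

theorem ExpPtolemaic.exp_le (hP : ExpPtolemaic X) (a b c x : X) :
    Real.exp ((dist a c + dist x b) / 2) ≤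
      Real.exp ((dist a b + dist x c) / 2) + Real.exp ((dist b c + dist x a) / 2) := by
  simpa only [add_div, Real.exp_add] using hP a b c x

/-- For `p` and `q` far away on asymptotic rays the right side is exponentially small. This gives
both the independence of Busemann functions from the ray and their continuity. -/
theorem ExpPtolemaic.abs_exp_sub_le (hP : ExpPtolemaic X) (x y p q : X) :
    |Real.exp ((dist x p - dist y p) / 2) - Real.exp ((dist x q - dist y q) / 2)| ≤
      Real.exp ((dist x y + dist p q - dist y p - dist y q) / 2) := by
  have key : ∀ p q : X, Real.exp ((dist x p - dist y p) / 2) -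
      Real.exp ((dist x q - dist y q) / 2) ≤
      Real.exp ((dist x y + dist p q - dist y p - dist y q) / 2) := by
    intro p q
    have h := mul_le_mul_of_nonneg_right (hP.exp_le x q p y)
      (Real.exp_pos ((- dist y p - dist y q) / 2)).le
    rw [add_mul, ← Real.exp_add, ← Real.exp_add, ← Real.exp_add, dist_comm q p, dist_comm y x] at h
    rw [show (dist x p - dist y p) / 2 = (dist x p + dist y q) / 2 + (-dist y p - dist y q) / 2 by
        ring, show (dist x q - dist y q) / 2 =
          (dist x q + dist y p) / 2 + (-dist y p - dist y q) / 2 by ring,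
      show (dist x y + dist p q - dist y p - dist y q) / 2 =
        (dist p q + dist x y) / 2 + (-dist y p - dist y q) / 2 by ring]
    linarith
  rw [abs_sub_le_iff]
  refine ⟨key p q, (key q p).trans (le_of_eq ?_)⟩
  rw [dist_comm q p]
  ring_nf

theorem GeodesicRay.dist_eq (ρ : GeodesicRay X) (s t : ℝ≥0) :
    dist (ρ.1 s) (ρ.1 t) = |(s : ℝ) - t| := by
  rw [ρ.2.dist_eq, NNReal.dist_eq]

theorem GeodesicRay.dist_of_le (ρ : GeodesicRay X) {s t : ℝ≥0} (h : s ≤ t) :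
    dist (ρ.1 s) (ρ.1 t) = (t : ℝ) - s := by
  rw [ρ.dist_eq, abs_sub_comm, abs_of_nonneg (sub_nonneg.2 (NNReal.coe_le_coe.2 h))]

theorem GeodesicRay.antitone_dist_sub (ρ : GeodesicRay X) (x : X) :
    Antitone fun t : ℝ≥0 => dist x (ρ.1 t) - t := by
  intro s t h
  have := dist_triangle x (ρ.1 s) (ρ.1 t)
  rw [ρ.dist_of_le h] at this
  change dist x (ρ.1 t) - t ≤ dist x (ρ.1 s) - s
  linarith

theorem GeodesicRay.le_dist (ρ : GeodesicRay X) (x : X) (t : ℝ≥0) :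
    (t : ℝ) - dist x (ρ.1 0) ≤ dist x (ρ.1 t) := by
  have := dist_triangle (ρ.1 0) x (ρ.1 t)
  rw [ρ.dist_of_le zero_le, NNReal.coe_zero, sub_zero] at this
  linarith [dist_comm x (ρ.1 0)]

theorem GeodesicRay.exists_tendsto_dist_sub (ρ : GeodesicRay X) (x : X) :
    ∃ l, Tendsto (fun t : ℝ≥0 => dist x (ρ.1 t) - t) atTop (𝓝 l) :=
  ⟨_, tendsto_atTop_ciInf (ρ.antitone_dist_sub x) ⟨- dist x (ρ.1 0), by
    rintro _ ⟨t, rfl⟩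
    change _ ≤ dist x (ρ.1 t) - t
    linarith [ρ.le_dist x t]⟩⟩

theorem GeodesicRay.exists_tendsto_sub (ρ : GeodesicRay X) (x y : X) :
    ∃ l, Tendsto (fun t : ℝ≥0 => dist x (ρ.1 t) - dist y (ρ.1 t)) atTop (𝓝 l) := by
  obtain ⟨l, hl⟩ := ρ.exists_tendsto_dist_sub x
  obtain ⟨l', hl'⟩ := ρ.exists_tendsto_dist_sub y
  exact ⟨l - l', (hl.sub hl').congr fun t => by ring⟩

theorem NNReal.tendsto_exp_sub_atTop (C : ℝ) :
    Tendsto (fun t : ℝ≥0 => Real.exp (C - t)) atTop (𝓝 0) := by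
  have h1 : Tendsto (fun t : ℝ≥0 => -(t : ℝ)) atTop atBot :=
    tendsto_neg_atTop_atBot.comp (NNReal.tendsto_coe_atTop.2 tendsto_id)
  have h2 : Tendsto (fun t : ℝ≥0 => C - (t : ℝ)) atTop atBot :=
    (tendsto_atBot_add_const_left _ C h1).congr fun t => by ring
  exact Real.tendsto_exp_atBot.comp h2

/-- The Busemann function may be computed along any representing ray. -/
theorem ExpPtolemaic.tendsto_busemann (hP : ExpPtolemaic X) (ρ : GeodesicRay X) (x y : X) :
    Tendsto (fun t : ℝ≥0 => dist x (ρ.1 t) - dist y (ρ.1 t)) atTop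
      (𝓝 (busemann (Quotient.mk (asymptoticSetoid X) ρ) x y)) := by
  set ρ' := (Quotient.mk (asymptoticSetoid X) ρ).out with hρ'
  obtain ⟨K, hK⟩ : ∃ K : ℝ, ∀ t : ℝ≥0, dist (ρ'.1 t) (ρ.1 t) ≤ K :=
    Quotient.mk_out (s := asymptoticSetoid X) ρ
  obtain ⟨l, hl⟩ := ρ.exists_tendsto_sub x y
  obtain ⟨l', hl'⟩ := ρ'.exists_tendsto_sub x y
  have hb : busemann (Quotient.mk (asymptoticSetoid X) ρ) x y = l' := hl'.limUnder_eq
  rw [hb]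
  have hexp : Continuous fun r : ℝ => Real.exp (r / 2) := by fun_prop
  have h1 := (((hexp.tendsto l).comp hl).sub ((hexp.tendsto l').comp hl')).abs
  have h2 : |Real.exp (l / 2) - Real.exp (l' / 2)| ≤ 0 := by
    refine le_of_tendsto_of_tendsto' h1 (NNReal.tendsto_exp_sub_atTop
      ((dist x y + K + dist y (ρ.1 0) + dist y (ρ'.1 0)) / 2)) fun t => ?_
    refine (hP.abs_exp_sub_le x y _ _).trans (Real.exp_le_exp.2 ?_)
    have := hK t
    rw [dist_comm] at this
    linarith [ρ.le_dist y t, ρ'.le_dist y t]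
  have h3 : Real.exp (l / 2) = Real.exp (l' / 2) := by
    linarith [abs_nonpos_iff.1 h2]
  have h4 : l = l' := by linarith [Real.exp_injective h3]
  rwa [← h4]

theorem ExpPtolemaic.busemann_add (hP : ExpPtolemaic X) (ξ : BoundaryAtInfinity X) (x y z : X) :
    busemann ξ x y + busemann ξ y z = busemann ξ x z := by
  induction ξ using Quotient.inductionOn with | h ρ =>
  refine tendsto_nhds_unique
    (((hP.tendsto_busemann ρ x y).add (hP.tendsto_busemann ρ y z)).congr fun t => ?_)
    (hP.tendsto_busemann ρ x z)
  ring

theorem ExpPtolemaic.neg_dist_le_busemann (hP : ExpPtolemaic X) (ξ : BoundaryAtInfinity X)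
    (x y : X) : - dist x y ≤ busemann ξ x y := by
  induction ξ using Quotient.inductionOn with | h ρ =>
  exact ge_of_tendsto' (hP.tendsto_busemann ρ x y) fun t => by
    linarith [dist_triangle y x (ρ.1 t), dist_comm x y]

theorem ExpPtolemaic.busemann_ray (hP : ExpPtolemaic X) (ρ : GeodesicRay X) (s t : ℝ≥0) :
    busemann (Quotient.mk (asymptoticSetoid X) ρ) (ρ.1 s) (ρ.1 t) = (t : ℝ) - s := by
  refine tendsto_nhds_unique (hP.tendsto_busemann ρ _ _) (tendsto_const_nhds.congr' ?_)
  filter_upwards [eventually_ge_atTop s, eventually_ge_atTop t] with T hs ht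
  rw [ρ.dist_of_le hs, ρ.dist_of_le ht]
  ring

theorem ExpPtolemaic.sub_dist_le_busemann (hP : ExpPtolemaic X) (ρ : GeodesicRay X) (t : ℝ≥0)
    (y : X) : (t : ℝ) - dist (ρ.1 t) y ≤
      busemann (Quotient.mk (asymptoticSetoid X) ρ) (ρ.1 0) y := by
  rw [← hP.busemann_add _ _ (ρ.1 t), hP.busemann_ray]
  have := hP.neg_dist_le_busemann (Quotient.mk (asymptoticSetoid X) ρ) (ρ.1 t) y
  simp only [NNReal.coe_zero]
  linarith

theorem ExpPtolemaic.tendsto_sub_dist (hP : ExpPtolemaic X) (ρ : GeodesicRay X) (y : X) :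
    Tendsto (fun t : ℝ≥0 => (t : ℝ) - dist y (ρ.1 t)) atTop
      (𝓝 (busemann (Quotient.mk (asymptoticSetoid X) ρ) (ρ.1 0) y)) := by
  refine (hP.tendsto_busemann ρ _ y).congr fun t => ?_
  rw [ρ.dist_of_le zero_le, NNReal.coe_zero, sub_zero]

/-- `ξ ↦ β_ξ(x, y)` is continuous. -/
theorem ExpPtolemaic.continuous_busemann (hP : ExpPtolemaic X) (x y : X) :
    Continuous fun ξ : BoundaryAtInfinity X => busemann ξ x y := by
  suffices h : Continuous fun ρ : GeodesicRay X =>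
      Real.exp (busemann (Quotient.mk (asymptoticSetoid X) ρ) x y / 2) by
    refine (isQuotientMap_quot_mk (r := (asymptoticSetoid X).r)).continuous_iff.2 ?_
    have h2 := (h.log fun ρ => (Real.exp_pos _).ne').const_mul 2
    refine h2.congr fun ρ => ?_
    rw [Real.log_exp]
    exact mul_div_cancel₀ _ two_ne_zero
  have happrox : ∀ (ρ : GeodesicRay X) (T : ℝ≥0),
      |Real.exp ((dist x (ρ.1 T) - dist y (ρ.1 T)) / 2) -
        Real.exp (busemann (Quotient.mk (asymptoticSetoid X) ρ) x y / 2)| ≤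
      Real.exp (dist x y / 2 + dist y (ρ.1 0) - T) := by
    intro ρ T
    have hexp : Continuous fun r : ℝ => Real.exp (r / 2) := by fun_prop
    refine le_of_tendsto (((((hexp.tendsto _).comp (hP.tendsto_busemann ρ x y)).const_sub _)).abs)
      ?_
    filter_upwards [eventually_ge_atTop T] with T' hT
    refine (hP.abs_exp_sub_le x y _ _).trans (Real.exp_le_exp.2 ?_)
    rw [ρ.dist_of_le hT]
    linarith [ρ.le_dist y T, ρ.le_dist y T']
  have heval : ∀ t : ℝ≥0, Continuous fun ρ : GeodesicRay X => ρ.1 t := fun t =>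
    (continuous_eval_const t).comp continuous_subtype_val
  -- The error at time `T` depends on the ray only through `d(y, ρ 0)`, which is bounded near `ρ₀`:
  -- the limit is locally uniform.
  refine continuous_of_locally_uniform_approx_of_continuousAt fun ρ₀ u hu => ?_
  obtain ⟨ε, hε, hεu⟩ := Metric.mem_uniformity_dist.1 hu
  obtain ⟨T, hT⟩ := ((NNReal.tendsto_exp_sub_atTop
    (dist x y / 2 + (dist y (ρ₀.1 0) + 1))).eventually_lt_const hε).exists
  have hcont : Continuous fun ρ : GeodesicRay X => dist y (ρ.1 0) :=
    continuous_const.dist (heval 0)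
  refine ⟨_, hcont.continuousAt.eventually_lt (continuousAt_const (y := dist y (ρ₀.1 0) + 1))
    (lt_add_one _), fun ρ => Real.exp ((dist x (ρ.1 T) - dist y (ρ.1 T)) / 2), ?_, ?_⟩
  · have := heval T
    fun_prop
  · intro ρ hρ
    apply hεu
    rw [dist_comm, Real.dist_eq]
    refine ((happrox ρ T).trans (Real.exp_le_exp.2 ?_)).trans_lt hT
    have : dist y (ρ.1 0) < dist y (ρ₀.1 0) + 1 := hρ
    linarith

/-- One ultrafilter gives limits for all parameters at once, in place of an extraction of
subsequences. -/
theorem exists_tendsto_hyperfilter [ProperSpace X] {ι : Type*} (f : ℕ → ι → X) (z : X)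
    (R : ι → ℝ) (h : ∀ i, ∀ᶠ n in atTop, dist (f n i) z ≤ R i) :
    ∃ g : ι → X, ∀ i, Tendsto (fun n => f n i) (hyperfilter ℕ) (𝓝 (g i)) := by
  have : ∀ i, ∃ x, Tendsto (fun n => f n i) (hyperfilter ℕ) (𝓝 x) := by
    intro i
    obtain ⟨x, -, hx⟩ := (isCompact_closedBall z (R i)).ultrafilter_le_nhds
      ((hyperfilter ℕ).map fun n => f n i) (by
        rw [Filter.le_principal_iff]
        exact Nat.hyperfilter_le_atTop (h i))
    exact ⟨x, hx⟩
  exact ⟨fun i => (this i).choose, fun i => (this i).choose_spec⟩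

/-- The geodesic ray given by a distance preserving map. -/
def GeodesicRay.ofDist (σ : ℝ≥0 → X) (h : ∀ s t, dist (σ s) (σ t) = |(s : ℝ) - t|) :
    GeodesicRay X :=
  have hi : Isometry σ := Isometry.of_dist_eq fun s t => by rw [h, NNReal.dist_eq]
  ⟨⟨σ, hi.continuous⟩, hi⟩

/-- Every point at infinity is the endpoint of a ray starting from a given point. -/
theorem IsCATNegOneSpace.exists_ray [ProperSpace X] (hX : IsCATNegOneSpace X)
    (ξ : BoundaryAtInfinity X) (x : X) :
    ∃ ρ : GeodesicRay X, ρ.1 0 = x ∧ Quotient.mk (asymptoticSetoid X) ρ = ξ := by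
  have hP := hX.expPtolemaic
  induction ξ using Quotient.inductionOn with | h ρ =>
  choose σ hσ using fun n : ℕ => hX.geodesic x (ρ.1 n)
  set D := dist x (ρ.1 0)
  have hL : ∀ n : ℕ, (n : ℝ) - D ≤ dist x (ρ.1 n) := fun n => ρ.le_dist x n
  have hev : ∀ t : ℝ≥0, ∀ᶠ n : ℕ in atTop, (t : ℝ) ∈ Set.Icc 0 (dist x (ρ.1 n)) ∧ t ≤ n := by
    intro t
    obtain ⟨N, hN⟩ := exists_nat_ge ((t : ℝ) + D)
    filter_upwards [eventually_ge_atTop N] with n hn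
    have hn' : (N : ℝ) ≤ n := Nat.cast_le.2 hn
    have : 0 ≤ D := dist_nonneg
    exact ⟨⟨t.2, by linarith [hL n]⟩, NNReal.coe_le_coe.1 (by
      rw [NNReal.coe_natCast]; linarith)⟩
  have hdist : ∀ s t : ℝ≥0, ∀ᶠ n : ℕ in atTop, dist (σ n s) (σ n t) = |(s : ℝ) - t| := by
    intro s t
    filter_upwards [hev s, hev t] with n hs ht
    exact (hσ n).2.2 _ hs.1 _ ht.1
  have hx : ∀ t : ℝ≥0, ∀ᶠ n : ℕ in atTop, dist (σ n t) x = t := by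
    intro t
    filter_upwards [hdist t 0] with n hn
    rw [NNReal.coe_zero, (hσ n).1] at hn
    rw [hn]; simp
  -- The Ptolemaic inequality for `σ n t`, `ρ n`, `ρ t`, `x` bounds the distance between the segment
  -- and the ray uniformly in `n`.
  have hasym : ∀ t : ℝ≥0, ∀ᶠ n : ℕ in atTop,
      dist (σ n t) (ρ.1 t) ≤ D + 2 * Real.log 2 := by
    intro t
    filter_upwards [hev t, hx t] with n hn hxt
    have h := hP.exp_le (σ n t) (ρ.1 n) (ρ.1 t) x
    have e1 : dist (σ n t) (ρ.1 n) = dist x (ρ.1 n) - t := by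
      have := (hσ n).2.2 _ hn.1 _ ⟨dist_nonneg, le_rfl⟩
      rw [(hσ n).2.1, abs_sub_comm, abs_of_nonneg (sub_nonneg.2 hn.1.2)] at this
      exact this
    have e2 : dist (ρ.1 n) (ρ.1 t) = n - t := by rw [dist_comm, ρ.dist_of_le hn.2]; simp
    have e3 : dist x (ρ.1 t) ≤ D + t := by
      have := dist_triangle x (ρ.1 0) (ρ.1 t)
      rwa [ρ.dist_of_le zero_le, NNReal.coe_zero, sub_zero] at this
    rw [dist_comm x (σ n t), hxt, e1, e2] at h
    have h1 : Real.exp ((dist x (ρ.1 n) - t + dist x (ρ.1 t)) / 2) ≤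
        Real.exp ((dist x (ρ.1 n) + D) / 2) := Real.exp_le_exp.2 (by linarith)
    have h2 : Real.exp (((n : ℝ) - t + t) / 2) ≤ Real.exp ((dist x (ρ.1 n) + D) / 2) :=
      Real.exp_le_exp.2 (by linarith [hL n])
    have h3 : Real.exp ((dist (σ n t) (ρ.1 t) + dist x (ρ.1 n)) / 2) ≤
        Real.exp (Real.log 2 + (dist x (ρ.1 n) + D) / 2) := by
      rw [Real.exp_add, Real.exp_log two_pos]; linarith
    linarith [Real.exp_le_exp.1 h3]
  obtain ⟨g, hg⟩ := exists_tendsto_hyperfilter (fun n (t : ℝ≥0) => σ n t) x (fun t => (t : ℝ))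
    fun t => (hx t).mono fun n hn => hn.le
  have U := Nat.hyperfilter_le_atTop
  refine ⟨GeodesicRay.ofDist g fun s t => ?_, ?_, Quotient.sound ⟨D + 2 * Real.log 2, fun t => ?_⟩⟩
  · exact tendsto_nhds_unique ((hg s).dist (hg t))
      (tendsto_const_nhds.congr' ((hdist s t).filter_mono U |>.mono fun n hn => hn.symm))
  · refine tendsto_nhds_unique (hg 0) (tendsto_const_nhds.congr fun n => ?_)
    exact (hσ n).1.symm
  · exact le_of_tendsto ((hg t).dist tendsto_const_nhds) ((hasym t).filter_mono U)

end Rays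

/-! ### Visual distances and obstacles at infinity. -/

section Visual

variable {X : Type*} [MetricSpace X]

/-- The exponential `exp (-(a|b)_o)` of the Gromov product. -/
noncomputable def visualDist (o a b : X) : ℝ := Real.exp ((dist a b - dist o a - dist o b) / 2)

/-- The exponential `exp (-(a|ξ)_o)` of the Gromov product of `a` with a point at infinity `ξ`. -/
noncomputable def boundaryVisualDist (o a : X) (ξ : BoundaryAtInfinity X) : ℝ :=
  Real.exp (-(dist o a + busemann ξ o a) / 2)

theorem visualDist_comm (o a b : X) : visualDist o a b = visualDist o b a := by
  rw [visualDist, visualDist, dist_comm a b]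
  ring_nf

theorem ExpPtolemaic.visualDist_triangle (hP : ExpPtolemaic X) (o a b c : X) :
    visualDist o a c ≤ visualDist o a b + visualDist o b c := by
  have h := mul_le_mul_of_nonneg_right (hP.exp_le a b c o)
    (Real.exp_pos (-(dist o a + dist o b + dist o c) / 2)).le
  rw [add_mul, ← Real.exp_add, ← Real.exp_add, ← Real.exp_add] at h
  have e1 : (dist a c - dist o a - dist o c) / 2 =
    (dist a c + dist o b) / 2 + -(dist o a + dist o b + dist o c) / 2 := by ring
  have e2 : (dist a b - dist o a - dist o b) / 2 =
    (dist a b + dist o c) / 2 + -(dist o a + dist o b + dist o c) / 2 := by ring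
  have e3 : (dist b c - dist o b - dist o c) / 2 =
    (dist b c + dist o a) / 2 + -(dist o a + dist o b + dist o c) / 2 := by ring
  rwa [visualDist, visualDist, visualDist, e1, e2, e3]

theorem ExpPtolemaic.tendsto_visualDist (hP : ExpPtolemaic X) (o a : X) (ρ : GeodesicRay X) :
    Tendsto (fun t : ℝ≥0 => visualDist o a (ρ.1 t)) atTop
      (𝓝 (boundaryVisualDist o a (Quotient.mk (asymptoticSetoid X) ρ))) := by
  have hexp : Continuous fun r : ℝ => Real.exp (-(dist o a + r) / 2) := by fun_prop
  refine ((hexp.tendsto _).comp (hP.tendsto_busemann ρ o a)).congr fun t => ?_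
  simp only [Function.comp, visualDist]
  congr 1; ring

theorem ExpPtolemaic.continuous_boundaryVisualDist (hP : ExpPtolemaic X) (o a : X) :
    Continuous (boundaryVisualDist o a) := by
  have := hP.continuous_busemann o a
  unfold boundaryVisualDist
  fun_prop

theorem ExpPtolemaic.visualDist_le (hP : ExpPtolemaic X) (o a b : X) (ξ : BoundaryAtInfinity X) :
    visualDist o a b ≤ boundaryVisualDist o a ξ + boundaryVisualDist o b ξ := by
  induction ξ using Quotient.inductionOn with | h ρ =>
  refine ge_of_tendsto' ((hP.tendsto_visualDist o a ρ).add (hP.tendsto_visualDist o b ρ))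
    fun t => ?_
  rw [visualDist_comm o b]
  exact hP.visualDist_triangle o a _ b

theorem ExpPtolemaic.boundaryVisualDist_le (hP : ExpPtolemaic X) (o a b : X)
    (ξ : BoundaryAtInfinity X) :
    boundaryVisualDist o a ξ ≤ visualDist o a b + boundaryVisualDist o b ξ := by
  induction ξ using Quotient.inductionOn with | h ρ =>
  exact le_of_tendsto_of_tendsto' (hP.tendsto_visualDist o a ρ)
    ((hP.tendsto_visualDist o b ρ).const_add _) fun t => hP.visualDist_triangle o a b _

/-- Two triangle inequalities through a point tending to `η`; this avoids a visual distance between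
two points at infinity. -/
theorem ExpPtolemaic.boundaryVisualDist_le_add (hP : ExpPtolemaic X) (o a b : X)
    (ξ η : BoundaryAtInfinity X) :
    boundaryVisualDist o a ξ ≤
      boundaryVisualDist o a η + boundaryVisualDist o b ξ + boundaryVisualDist o b η := by
  induction ξ using Quotient.inductionOn with | h ρ =>
  induction η using Quotient.inductionOn with | h ρ' =>
  refine le_of_tendsto_of_tendsto' (hP.tendsto_visualDist o a ρ)
    (((hP.tendsto_visualDist o a ρ').add (hP.tendsto_visualDist o b ρ)).add
      (hP.tendsto_visualDist o b ρ')) fun t => ?_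
  have h1 := hP.visualDist_triangle o a (ρ'.1 t) (ρ.1 t)
  have h2 := hP.visualDist_triangle o (ρ'.1 t) b (ρ.1 t)
  rw [visualDist_comm o (ρ'.1 t) b] at h2
  linarith

/-- A ray from `o` through a point `y` stays visually close to every point close to `y`. -/
theorem ExpPtolemaic.boundaryVisualDist_ray_le (hP : ExpPtolemaic X) (ρ : GeodesicRay X) (t : ℝ≥0)
    (c : X) : boundaryVisualDist (ρ.1 0) c (Quotient.mk (asymptoticSetoid X) ρ) ≤
      Real.exp (dist (ρ.1 t) c - dist (ρ.1 0) c) := by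
  refine Real.exp_le_exp.2 ?_
  have h1 := hP.sub_dist_le_busemann ρ t c
  have h2 := dist_triangle (ρ.1 0) (ρ.1 t) c
  rw [ρ.dist_of_le zero_le, NNReal.coe_zero, sub_zero] at h2
  linarith

theorem exp_neg_three_halves_lt : Real.exp (-1.5) < 0.2232 := by
  refine lt_of_pow_lt_pow_left₀ 2 (by norm_num) ?_
  rw [← Real.exp_nat_mul, show ((2 : ℕ) : ℝ) * -1.5 = -3 by norm_num, Real.exp_neg,
    show (3 : ℝ) = (3 : ℕ) * 1 by norm_num, Real.exp_nat_mul]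
  have := Real.exp_one_gt_d9
  calc (Real.exp 1 ^ 3)⁻¹ ≤ (2.7182 ^ 3)⁻¹ := by gcongr; linarith
    _ < 0.2232 ^ 2 := by norm_num

/-- As far as rays from `o` hitting a definitely shrunk copy are concerned, a ball or horoball may
be replaced by a ball. -/
theorem ExpPtolemaic.exists_ball_representative (hP : ExpPtolemaic X) (O : BallOrHoroball X)
    (hne : (O.shrink 1.52).Nonempty) (o : X) :
    ∃ (c : X) (r : ℝ), 0 < r ∧ Metric.ball c r ⊆ interior O.carrier ∧
      ∀ ρ : GeodesicRay X, ρ.1 0 = o → ∀ t, ρ.1 t ∈ O.shrink 1.52 →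
        boundaryVisualDist o c (Quotient.mk (asymptoticSetoid X) ρ) <
          0.23 * Real.exp (r - dist o c) := by
  cases O with
  | ball c r hr =>
    obtain ⟨z, hz⟩ := hne
    have hz' : dist z c ≤ r - 1.52 := hz
    refine ⟨c, r, by linarith [dist_nonneg (x := z) (y := c)],
      Metric.ball_subset_interior_closedBall, fun ρ hρ t ht => ?_⟩
    have ht' : dist (ρ.1 t) c ≤ r - 1.52 := ht
    subst hρ
    calc _ ≤ Real.exp (dist (ρ.1 t) c - dist (ρ.1 0) c) := hP.boundaryVisualDist_ray_le ρ t c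
      _ ≤ Real.exp (-1.5 + (r - dist (ρ.1 0) c)) := Real.exp_le_exp.2 (by linarith)
      _ < _ := by
        rw [Real.exp_add]
        exact mul_lt_mul_of_pos_right (exp_neg_three_halves_lt.trans (by norm_num))
          (Real.exp_pos _)
  | horoball ξ x s =>
    set ζ := ξ.out with hζ
    have hξ : Quotient.mk (asymptoticSetoid X) ζ = ξ := Quotient.out_eq ξ
    set r₀ := busemann ξ x (ζ.1 0) - s with hr₀
    have hb : ∀ n : ℝ≥0, busemann ξ x (ζ.1 n) = s + (r₀ + n) := by
      intro n
      rw [← hP.busemann_add ξ x (ζ.1 0)]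
      have := hP.busemann_ray ζ 0 n
      rw [hξ, NNReal.coe_zero, sub_zero] at this
      rw [this]; ring
    obtain ⟨τ, hτ⟩ := ζ.exists_tendsto_dist_sub o
    have hτle : ∀ n : ℝ≥0, τ ≤ dist o (ζ.1 n) - n := fun n =>
      (ζ.antitone_dist_sub o).le_of_tendsto hτ n
    -- The ball of center `ζ n` and radius `r₀ + n` is inside the horoball. For large `n`, its size
    -- seen from `o` almost equals the limit `exp (r₀ - τ)`, and the later points of `ζ` are
    -- visually close to its center.
    obtain ⟨n, hn1, hn2, hn3⟩ := ((hτ.eventually_le_const (show τ < τ + 0.01 by norm_num)).and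
      (((NNReal.tendsto_exp_sub_atTop (dist o (ζ.1 0))).eventually_le_const
        (show 0 < 0.001 * Real.exp (r₀ - (τ + 0.01)) by positivity)).and
        ((NNReal.tendsto_coe_atTop.2 tendsto_id).eventually_gt_atTop (-r₀)))).exists
    have hn3' : -r₀ < n := hn3
    refine ⟨ζ.1 n, r₀ + n, by linarith, interior_maximal (fun y hy => ?_) Metric.isOpen_ball,
      fun ρ hρ t ht => ?_⟩
    · have hy' : dist y (ζ.1 n) < r₀ + n := hy
      have h1 := hP.busemann_add ξ x (ζ.1 n) y
      have h2 := hP.neg_dist_le_busemann ξ (ζ.1 n) y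
      rw [hb n] at h1
      rw [dist_comm] at hy'
      change s ≤ busemann ξ x y
      linarith
    · have ht' : s + 1.52 ≤ busemann ξ x (ρ.1 t) := ht
      subst hρ
      have hlim := hP.tendsto_sub_dist ζ (ρ.1 t)
      have h1 := hP.busemann_add ξ x (ζ.1 0) (ρ.1 t)
      have h2 := hb 0
      rw [NNReal.coe_zero] at h2
      rw [hξ] at hlim
      -- A point `ζ m` further out, depending on `ρ t`, almost realizes the Busemann function at `ρ
      -- t`; the estimate is then moved back to the center `ζ n`, which must not depend on `ρ`.
      obtain ⟨m, hm1, hm2⟩ := ((hlim.eventually_const_le (show 1.51 - r₀ < _ by linarith)).and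
        (eventually_ge_atTop n)).exists
      have hm3 : boundaryVisualDist (ρ.1 0) (ζ.1 m) (Quotient.mk (asymptoticSetoid X) ρ) ≤
          Real.exp (-1.5 + (r₀ - (τ + 0.01))) := by
        refine (hP.boundaryVisualDist_ray_le ρ t _).trans (Real.exp_le_exp.2 ?_)
        linarith [hτle m]
      have hm4 : visualDist (ρ.1 0) (ζ.1 n) (ζ.1 m) ≤ Real.exp (dist (ρ.1 0) (ζ.1 0) - n) := by
        refine Real.exp_le_exp.2 ?_
        rw [ζ.dist_of_le hm2]
        linarith [ζ.le_dist (ρ.1 0) n, ζ.le_dist (ρ.1 0) m]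
      have hm5 := hP.boundaryVisualDist_le (ρ.1 0) (ζ.1 n) (ζ.1 m)
        (Quotient.mk (asymptoticSetoid X) ρ)
      have hm6 : Real.exp (r₀ - (τ + 0.01)) ≤ Real.exp (r₀ + n - dist (ρ.1 0) (ζ.1 n)) :=
        Real.exp_le_exp.2 (by linarith)
      rw [Real.exp_add] at hm3
      have hm7 := mul_lt_mul_of_pos_right exp_neg_three_halves_lt
        (Real.exp_pos (r₀ - (τ + 0.01)))
      have := Real.exp_pos (r₀ + n - dist (ρ.1 0) (ζ.1 n))
      linarith

theorem add_le_dist_of_disjoint_ball (hX : IsGeodesicSpace X) {c c' : X} {r r' : ℝ} (hr : 0 < r)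
    (hr' : 0 < r') (h : Disjoint (Metric.ball c r) (Metric.ball c' r')) : r + r' ≤ dist c c' := by
  by_contra! hcon
  obtain ⟨σ, h0, h1, hσ⟩ := hX c c'
  set d := dist c c'
  have hd : 0 ≤ d := dist_nonneg
  set s := d * r / (r + r') with hs
  have hs0 : 0 ≤ s := by positivity
  have hsr : s < r := by
    rw [hs, div_lt_iff₀ (by positivity)]; nlinarith
  have hsd : s ≤ d := by
    rw [hs, div_le_iff₀ (by positivity)]; nlinarith
  have hsr' : d - s < r' := by
    have : d - s = d * r' / (r + r') := by rw [hs]; field_simp; ring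
    rw [this, div_lt_iff₀ (by positivity)]; nlinarith
  suffices h' : σ s ∈ Metric.ball c r ∧ σ s ∈ Metric.ball c' r' from
    Set.disjoint_left.1 h h'.1 h'.2
  constructor
  · have := hσ s ⟨hs0, hsd⟩ 0 ⟨le_rfl, hd⟩
    rw [Metric.mem_ball, ← h0, this, sub_zero, abs_of_nonneg hs0]
    exact hsr
  · have := hσ s ⟨hs0, hsd⟩ d ⟨hd, le_rfl⟩
    rw [Metric.mem_ball, ← h1, this, abs_sub_comm, abs_of_nonneg (by linarith)]
    exact hsr'

/-- Along a visually large enough path at infinity there is a point such that the rays from `o`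
towards it avoid all shrunk balls and horoballs. -/
theorem IsCATNegOneSpace.exists_boundary_avoiding (hX : IsCATNegOneSpace X) (o : X) {A : Type*}
    (H : A → BallOrHoroball X)
    (hdisj : Pairwise fun α β => Disjoint (interior (H α).carrier) (interior (H β).carrier))
    {R : ℝ} (hR : ∀ α c r, 0 < r → Metric.ball c r ⊆ interior (H α).carrier → R + r ≤ dist o c)
    {f : ℝ → BoundaryAtInfinity X} (hf : Continuous f)
    (hends : ∀ c, 0.66 * Real.exp (-R) <
      boundaryVisualDist o c (f 0) + boundaryVisualDist o c (f 1)) :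
    ∃ t ∈ Set.Icc (0 : ℝ) 1, ∀ ρ : GeodesicRay X, ρ.1 0 = o →
      Quotient.mk (asymptoticSetoid X) ρ = f t → ∀ α s, ρ.1 s ∉ (H α).shrink 1.52 := by
  have hP := hX.expPtolemaic
  let B := {α // ((H α).shrink 1.52).Nonempty}
  choose c r hr hc hhit using fun α : B => hP.exists_ball_representative (H α.1) α.2 o
  have hδ : ∀ α, Real.exp (r α - dist o (c α)) ≤ Real.exp (-R) := fun α =>
    Real.exp_le_exp.2 (by linarith [hR α.1 (c α) (r α) (hr α) (hc α)])
  have hsep : ∀ α β, α ≠ β → ∀ t,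
      √(Real.exp (r α - dist o (c α))) * √(Real.exp (r β - dist o (c β))) ≤
        boundaryVisualDist o (c α) (f t) + boundaryVisualDist o (c β) (f t) := by
    intro α β hαβ t
    refine le_trans ?_ (hP.visualDist_le o (c α) (c β) (f t))
    rw [← Real.exp_half, ← Real.exp_half, ← Real.exp_add]
    refine Real.exp_le_exp.2 ?_
    have := add_le_dist_of_disjoint_ball hX.geodesic (hr α) (hr β)
      ((hdisj (fun h => hαβ (Subtype.ext h))).mono (hc α) (hc β))
    linarith
  obtain ⟨t, ht, h⟩ := exists_avoiding_of_separated
    (fun α => (hP.continuous_boundaryVisualDist o (c α)).comp hf) (fun α => Real.exp_pos _)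
    hδ hsep (fun α β u v => hP.boundaryVisualDist_le_add o (c α) (c β) (f u) (f v))
    (fun α => lt_of_le_of_lt (mul_le_mul_of_nonneg_left (hδ α) (by norm_num)) (hends (c α)))
  refine ⟨t, ht, fun ρ hρ hρt α s hs => ?_⟩
  have h1 := hhit ⟨α, _, hs⟩ ρ hρ s hs
  rw [hρt] at h1
  exact (h ⟨α, _, hs⟩).not_gt h1

end Visual

/-! ### Rays from a point outside, and paths away from a given end. -/

section Lines

variable {X : Type*} [MetricSpace X]

theorem HasExtendibleGeodesics.exists_line (hext : HasExtendibleGeodesics X)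
    (hX : IsGeodesicSpace X) (a b : X) : ∃ γ : ℝ → X, Isometry γ ∧ γ 0 = a ∧ γ (dist a b) = b := by
  obtain ⟨σ, h0, h1, hσ⟩ := hX a b
  obtain ⟨γ, hγ, he⟩ := hext 0 (dist a b) σ dist_nonneg hσ
  exact ⟨γ, hγ, by rw [he ⟨le_rfl, dist_nonneg⟩, h0], by rw [he ⟨dist_nonneg, le_rfl⟩, h1]⟩

/-- The ray `t ↦ γ(t)`, for `γ` a geodesic line. -/
def GeodesicLine.forwardRay (γ : GeodesicLine X) : GeodesicRay X :=
  GeodesicRay.ofDist (fun t => γ.1 t) fun s t => by rw [γ.2.dist_eq, Real.dist_eq]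

/-- Avoiding a set shrunk by `s` leaves room `t - s` around the set shrunk by `t`, which is what
passing to limits requires. -/
theorem BallOrHoroball.mem_shrink_of_dist_le (hP : ExpPtolemaic X) (O : BallOrHoroball X)
    {y y' : X} {s t : ℝ} (h : y ∈ O.shrink t) (hd : dist y y' ≤ t - s) : y' ∈ O.shrink s := by
  cases O with
  | ball c r hr =>
    have h' : dist y c ≤ r - t := h
    change dist y' c ≤ r - s
    linarith [dist_triangle y' y c, dist_comm y' y]
  | horoball ξ x u =>
    have h' : u + t ≤ busemann ξ x y := h
    change u + s ≤ busemann ξ x y'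
    have h1 := hP.busemann_add ξ x y y'
    have h2 := hP.neg_dist_le_busemann ξ y y'
    linarith

/-- Seen from `γ 0`, the points `γ (-t)` and `γ t` are at visual distance exactly one. -/
theorem ExpPtolemaic.one_le_boundaryVisualDist_add (hP : ExpPtolemaic X) (γ : GeodesicLine X)
    (c : X) : 1 ≤ boundaryVisualDist (γ.1 0) c (GeodesicLine.start γ) +
      boundaryVisualDist (γ.1 0) c (Quotient.mk (asymptoticSetoid X) (GeodesicLine.forwardRay γ)) := by
  refine ge_of_tendsto' ((hP.tendsto_visualDist (γ.1 0) c (GeodesicLine.backwardRay γ)).add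
    (hP.tendsto_visualDist (γ.1 0) c (GeodesicLine.forwardRay γ))) fun t => ?_
  have h := hP.visualDist_triangle (γ.1 0) (γ.1 (-t)) c (γ.1 t)
  rw [visualDist_comm _ _ c] at h
  refine le_trans (le_of_eq ?_) h
  have ht : (0 : ℝ) ≤ t := t.2
  rw [visualDist, γ.2.dist_eq, γ.2.dist_eq, γ.2.dist_eq, Real.dist_eq, Real.dist_eq, Real.dist_eq,
    abs_of_nonpos (by linarith), abs_of_nonneg (by linarith), abs_of_nonpos (by linarith),
    eq_comm, Real.exp_eq_one_iff]
  ring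

/-- Rays starting from a point outside the balls and horoballs and avoiding the shrunk ones. -/
theorem IsCATNegOneSpace.exists_ray_avoiding [ProperSpace X]
    (hX : IsCATNegOneSpace X) (hbdry : PathConnectedSpace (BoundaryAtInfinity X))
    (hext : HasExtendibleGeodesics X) {A : Type*} (H : A → BallOrHoroball X)
    (hdisj : Pairwise fun α β => Disjoint (interior (H α).carrier) (interior (H β).carrier))
    (x : X) (hx : x ∉ ⋃ α, (H α).carrier) :
    ∃ ρ : GeodesicRay X, ρ.1 0 = x ∧ ∀ (α : A) (t : ℝ≥0), ρ.1 t ∉ (H α).shrink 1.534 := by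
  have hP := hX.expPtolemaic
  -- Extending the degenerate segment at `x` gives a line through `x`.
  obtain ⟨γ, hγ, rfl, -⟩ := hext.exists_line hX.geodesic x x
  let γ' : GeodesicLine X := ⟨γ, hγ⟩
  let p := (hbdry.joined (GeodesicLine.start γ')
    (Quotient.mk (asymptoticSetoid X) (GeodesicLine.forwardRay γ'))).somePath
  obtain ⟨t, -, h⟩ := hX.exists_boundary_avoiding (γ 0) H hdisj (R := 0)
    (fun α c r hr hc => by
      rw [zero_add]
      by_contra! hcon
      exact hx (Set.mem_iUnion.2 ⟨α, interior_subset (hc hcon)⟩))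
    p.continuous_extend (fun c => by
      rw [p.extend_zero, p.extend_one, neg_zero, Real.exp_zero]
      exact lt_of_lt_of_le (by norm_num) (hP.one_le_boundaryVisualDist_add γ' c))
  obtain ⟨ρ, h0, hρ⟩ := hX.exists_ray (p.extend t) (γ 0)
  exact ⟨ρ, h0, fun α s hs => h ρ h0 hρ α s
    ((H α).mem_shrink_of_dist_le hP hs (by rw [dist_self]; norm_num))⟩

/-- If `z` is almost on the way from `ρ 0` to the endpoint, then the ray passes near `z` at time
`d(ρ 0, z)`. -/
theorem ExpPtolemaic.exp_half_dist_ray_le (hP : ExpPtolemaic X) (ρ : GeodesicRay X) (z : X) :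
    Real.exp (dist (ρ.1 (nndist (ρ.1 0) z)) z / 2) ≤ 1 + Real.exp ((dist (ρ.1 0) z -
      busemann (Quotient.mk (asymptoticSetoid X) ρ) (ρ.1 0) z) / 2) := by
  set d := nndist (ρ.1 0) z with hd
  have hexp : Continuous fun r : ℝ => 1 + Real.exp ((dist (ρ.1 0) z - r) / 2) := by fun_prop
  refine ge_of_tendsto ((hexp.tendsto _).comp (hP.tendsto_sub_dist ρ z)) ?_
  filter_upwards [eventually_ge_atTop d] with t ht
  have h := mul_le_mul_of_nonneg_right (hP.exp_le (ρ.1 d) (ρ.1 t) z (ρ.1 0))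
    (Real.exp_pos (-(t : ℝ) / 2)).le
  rw [add_mul, ← Real.exp_add, ← Real.exp_add, ← Real.exp_add, ρ.dist_of_le ht,
    ρ.dist_of_le zero_le, ρ.dist_of_le zero_le, hd, coe_nndist, ← hd, NNReal.coe_zero,
    dist_comm (ρ.1 t) z] at h
  simp only [Function.comp]
  convert h using 2
  · ring
  · rw [eq_comm, Real.exp_eq_one_iff]; ring
  · congr 1; ring

theorem exp_neg_two_lt : Real.exp (-2) < 0.14 := by
  rw [Real.exp_neg, show (2 : ℝ) = (2 : ℕ) * 1 by norm_num, Real.exp_nat_mul]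
  have := Real.exp_one_gt_d9
  calc (Real.exp 1 ^ 2)⁻¹ ≤ (2.7182 ^ 2)⁻¹ := by gcongr; linarith
    _ < 0.14 := by norm_num

/-- A path at infinity that, seen from points far away on the ray `ζ`, is visually large and stays
away from the endpoint of `ζ`. -/
theorem IsCATNegOneSpace.exists_path_away [ProperSpace X] (hX : IsCATNegOneSpace X)
    (hbdry : PathConnectedSpace (BoundaryAtInfinity X)) (hext : HasExtendibleGeodesics X)
    (ζ : GeodesicRay X) : ∃ f : ℝ → BoundaryAtInfinity X, Continuous f ∧
      (∀ t ∈ Set.Icc (0 : ℝ) 1, ∀ n : ℝ≥0, 2 ≤ n →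
        0.36 ≤ boundaryVisualDist (ζ.1 0) (ζ.1 n) (f t)) ∧
      ∀ n : ℝ≥0, 2 ≤ n → 0.86 ≤ boundaryVisualDist (ζ.1 0) (ζ.1 n) (f 0) ∧
        boundaryVisualDist (ζ.1 0) (ζ.1 n) (f 1) ≤ 0.5 := by
  have hP := hX.expPtolemaic
  have d2 : dist (ζ.1 2) (ζ.1 0) = 2 := by
    rw [dist_comm, ζ.dist_of_le zero_le]; simp
  -- Prolonging the segment from `ζ 2` to `ζ 0` beyond `ζ 0` gives an end `η` opposite to that of
  -- `ζ`. On a path from `η` to the end of `ζ`, a piece is kept on which the visual distance to `ζ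
  -- 2` goes from `1` to `0.5`; replacing `ζ 2` by `ζ n` costs at most `exp (-2) < 0.14`.
  obtain ⟨γ, hγ, h0, h1⟩ := hext.exists_line hX.geodesic (ζ.1 2) (ζ.1 0)
  let γ' : GeodesicLine X := ⟨γ, hγ⟩
  let η := Quotient.mk (asymptoticSetoid X) (GeodesicLine.forwardRay γ')
  let p := (hbdry.joined η (Quotient.mk (asymptoticSetoid X) ζ)).somePath
  have hstart : boundaryVisualDist (ζ.1 0) (ζ.1 2) η = 1 := by
    have := hP.busemann_ray (GeodesicLine.forwardRay γ') 2 0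
    have e2 : (GeodesicLine.forwardRay γ').1 2 = ζ.1 0 := by
      change γ ((2 : ℝ≥0) : ℝ) = _
      rw [← h1, d2]; simp
    have e0 : (GeodesicLine.forwardRay γ').1 0 = ζ.1 2 := by
      change γ ((0 : ℝ≥0) : ℝ) = _
      rw [← h0]; simp
    rw [e0, e2] at this
    rw [boundaryVisualDist, this, dist_comm, d2]
    simp
  have hend : boundaryVisualDist (ζ.1 0) (ζ.1 2) (Quotient.mk (asymptoticSetoid X) ζ) < 0.5 := by
    have := hP.busemann_ray ζ 0 2
    rw [boundaryVisualDist, this, dist_comm, d2]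
    refine lt_of_eq_of_lt ?_ (exp_neg_two_lt.trans (by norm_num))
    congr 1; simp
  obtain ⟨a, b, h0a, hab, hb1, hmid, hb, ha⟩ := exists_subinterval_of_le
    (g := fun t => boundaryVisualDist (ζ.1 0) (ζ.1 2) (p.extend t)) (s := 0) (h := 1)
    (K := 0.5) (K' := 1) ((hP.continuous_boundaryVisualDist _ _).comp p.continuous_extend)
    zero_le_one (by rw [p.extend_zero, hstart]) (by rw [p.extend_one]; exact hend.le)
    (by norm_num)
  have hlow : ∀ (ξ : BoundaryAtInfinity X) (n : ℝ≥0), 2 ≤ n →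
      boundaryVisualDist (ζ.1 0) (ζ.1 2) ξ - 0.14 ≤ boundaryVisualDist (ζ.1 0) (ζ.1 n) ξ := by
    intro ξ n hn
    have h := hP.boundaryVisualDist_le (ζ.1 0) (ζ.1 2) (ζ.1 n) ξ
    have : visualDist (ζ.1 0) (ζ.1 2) (ζ.1 n) = Real.exp (-2) := by
      rw [visualDist, ζ.dist_of_le hn, ζ.dist_of_le zero_le, ζ.dist_of_le zero_le]
      congr 1; simp; ring
    linarith [exp_neg_two_lt]
  have hmono : ∀ (ξ : BoundaryAtInfinity X) (n : ℝ≥0), 2 ≤ n →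
      boundaryVisualDist (ζ.1 0) (ζ.1 n) ξ ≤ boundaryVisualDist (ζ.1 0) (ζ.1 2) ξ := by
    intro ξ n hn
    refine Real.exp_le_exp.2 ?_
    have h1 := hP.busemann_add ξ (ζ.1 0) (ζ.1 2) (ζ.1 n)
    have h2 := hP.neg_dist_le_busemann ξ (ζ.1 2) (ζ.1 n)
    rw [ζ.dist_of_le hn] at h2
    rw [ζ.dist_of_le zero_le, ζ.dist_of_le zero_le]
    linarith
  refine ⟨fun t => p.extend (a + (b - a) * t), p.continuous_extend.comp (by fun_prop),
    fun t ht n hn => ?_, fun n hn => ⟨?_, ?_⟩⟩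
  · have := hmid (a + (b - a) * t) ⟨by nlinarith [ht.1], by nlinarith [ht.2]⟩
    have := hlow (p.extend (a + (b - a) * t)) n hn
    linarith
  · have := hlow (p.extend a) n hn
    simp only [mul_zero, add_zero]
    linarith
  · have := hmono (p.extend b) n hn
    simp only [mul_one, add_sub_cancel]
    linarith

end Lines

/-! ### Lines starting from the center of a horoball. -/

section HoroballCase

variable {X : Type*} [MetricSpace X]

/-- The translate `t ↦ ρ (T + t)` of a geodesic ray. -/
def GeodesicRay.shift (ρ : GeodesicRay X) (T : ℝ≥0) : GeodesicRay X :=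
  GeodesicRay.ofDist (fun t => ρ.1 (T + t)) fun s t => by
    rw [ρ.dist_eq]; push_cast; congr 1; ring

theorem GeodesicRay.mk_shift (ρ : GeodesicRay X) (T : ℝ≥0) :
    Quotient.mk (asymptoticSetoid X) (ρ.shift T) = Quotient.mk (asymptoticSetoid X) ρ := by
  refine Quotient.sound ⟨T, fun t => ?_⟩
  change dist (ρ.1 (T + t)) (ρ.1 t) ≤ T
  rw [ρ.dist_eq]
  push_cast
  rw [add_sub_cancel_right]
  exact (abs_of_nonneg T.coe_nonneg).le

/-- Rays starting from the points of a ray `ζ` which pass at bounded distance from `ζ 0` converge,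
along an ultrafilter, to a line starting at the endpoint of `ζ`. -/
theorem ExpPtolemaic.exists_limit_line [ProperSpace X] (hP : ExpPtolemaic X) (ζ : GeodesicRay X)
    (σ : ℕ → GeodesicRay X) (hσ : ∀ᶠ n in atTop, (σ n).1 0 = ζ.1 n) {M : ℝ}
    (hM : ∀ᶠ n : ℕ in atTop, Real.exp (dist ((σ n).1 n) (ζ.1 0) / 2) ≤ M) :
    ∃ γ : GeodesicLine X, GeodesicLine.start γ = Quotient.mk (asymptoticSetoid X) ζ ∧
      ∀ t : ℝ, Tendsto (fun n : ℕ => (σ n).1 (Real.toNNReal (n + t))) (hyperfilter ℕ)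
        (𝓝 (γ.1 t)) := by
  have hM0 : 0 < M := by
    obtain ⟨n, hn⟩ := hM.exists
    exact (Real.exp_pos _).trans_le hn
  have hlogM : ∀ᶠ n : ℕ in atTop, dist ((σ n).1 n) (ζ.1 0) ≤ 2 * Real.log M := by
    filter_upwards [hM] with n hn
    have := (Real.le_log_iff_exp_le hM0).2 hn
    linarith
  have hnn : ∀ t : ℝ, ∀ᶠ n : ℕ in atTop, 0 ≤ (n : ℝ) + t := by
    intro t
    filter_upwards [tendsto_natCast_atTop_atTop.eventually_ge_atTop (-t)] with n hn
    linarith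
  have hdist : ∀ s t : ℝ, ∀ᶠ n : ℕ in atTop,
      dist ((σ n).1 (Real.toNNReal (n + s))) ((σ n).1 (Real.toNNReal (n + t))) = |s - t| := by
    intro s t
    filter_upwards [hnn s, hnn t] with n hs ht
    rw [(σ n).dist_eq, Real.coe_toNNReal _ hs, Real.coe_toNNReal _ ht, add_sub_add_left_eq_sub]
  obtain ⟨g, hg⟩ := exists_tendsto_hyperfilter
    (fun n (t : ℝ) => (σ n).1 (Real.toNNReal (n + t))) (ζ.1 0) (fun t => |t| + 2 * Real.log M) (by
      intro t
      filter_upwards [hdist t 0, hlogM] with n hn hn'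
      rw [add_zero, Real.toNNReal_natCast, sub_zero] at hn
      linarith [dist_triangle ((σ n).1 (Real.toNNReal (n + t))) ((σ n).1 n) (ζ.1 0)])
  have U := Nat.hyperfilter_le_atTop
  have hiso : Isometry g := Isometry.of_dist_eq fun s t =>
    tendsto_nhds_unique ((hg s).dist (hg t))
      (tendsto_const_nhds.congr' ((hdist s t).filter_mono U |>.mono fun n hn =>
        hn.symm))
  refine ⟨⟨g, hiso⟩, Quotient.sound ⟨2 * Real.log (1 + M), fun t => ?_⟩, hg⟩
  change dist (g (-t)) (ζ.1 t) ≤ _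
  refine le_of_tendsto ((hg (-t)).dist tendsto_const_nhds) (Eventually.filter_mono U ?_)
  filter_upwards [hnn (-t), hσ, hM] with n hn h0 hMn
  set u := Real.toNNReal (n + -t) with hu
  have hu' : (u : ℝ) = n - t := by rw [hu, Real.coe_toNNReal _ hn]; ring
  have htn : t ≤ (n : ℝ≥0) := NNReal.coe_le_coe.1 (by rw [NNReal.coe_natCast]; linarith)
  have hun : u ≤ (n : ℝ≥0) := NNReal.coe_le_coe.1 (by
    rw [NNReal.coe_natCast, hu']; linarith [t.2])
  -- `σ n` and `ζ` are compared through the quadrilateral `σ n (n - t)`, `σ n n`, `ζ t`, `ζ n`, with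
  -- a bound independent of `n` and `t`.
  have h := hP.exp_le ((σ n).1 u) ((σ n).1 n) (ζ.1 t) ((σ n).1 0)
  have e1 : dist ((σ n).1 u) ((σ n).1 n) = t := by
    rw [(σ n).dist_of_le hun, hu']; simp
  have e2 : dist ((σ n).1 0) (ζ.1 t) = n - t := by
    rw [h0, dist_comm, ζ.dist_of_le htn]; simp
  have e3 : dist ((σ n).1 0) ((σ n).1 n) = n := by
    rw [(σ n).dist_of_le zero_le]; simp
  have e4 : dist ((σ n).1 0) ((σ n).1 u) = n - t := by
    rw [(σ n).dist_of_le zero_le, hu']; simp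
  have e5 : dist ((σ n).1 n) (ζ.1 t) ≤ dist ((σ n).1 n) (ζ.1 0) + t := by
    have := dist_triangle ((σ n).1 n) (ζ.1 0) (ζ.1 t)
    rwa [ζ.dist_of_le zero_le, NNReal.coe_zero, sub_zero] at this
  rw [e1, e2, e3, e4] at h
  have h1 : Real.exp ((dist ((σ n).1 n) (ζ.1 t) + (n - t)) / 2) ≤ M * Real.exp (n / 2) := by
    refine le_trans ?_ (mul_le_mul_of_nonneg_right hMn (Real.exp_pos _).le)
    rw [← Real.exp_add]
    exact Real.exp_le_exp.2 (by linarith)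
  rw [show (t : ℝ) + (n - t) = n by ring, add_div, Real.exp_add] at h
  have h2 : Real.exp (dist ((σ n).1 u) (ζ.1 t) / 2) ≤ 1 + M := by
    refine le_of_mul_le_mul_right ?_ (Real.exp_pos ((n : ℝ) / 2))
    linarith
  have := (Real.le_log_iff_exp_le (by linarith)).2 h2
  linarith

/-- Lines starting from the point at infinity of a horoball and avoiding the other shrunk balls and
horoballs. -/
theorem IsCATNegOneSpace.exists_line_avoiding [ProperSpace X]
    (hX : IsCATNegOneSpace X) (hbdry : PathConnectedSpace (BoundaryAtInfinity X))
    (hext : HasExtendibleGeodesics X) {A : Type*} (H : A → BallOrHoroball X)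
    (hdisj : Pairwise fun α β => Disjoint (interior (H α).carrier) (interior (H β).carrier))
    (α₀ : A) (ξ : BoundaryAtInfinity X) (x : X) (s : ℝ) (hα₀ : H α₀ = .horoball ξ x s) :
    ∃ γ : GeodesicLine X, GeodesicLine.start γ = ξ ∧
      ∀ α : A, α ≠ α₀ → ∀ t : ℝ, γ.1 t ∉ (H α).shrink 1.534 := by
  have hP := hX.expPtolemaic
  -- The representing ray is started late enough for `ζ 0` to lie in the horoball; `T = 0` if it is
  -- already there.
  set T := Real.toNNReal (s - busemann ξ x (ξ.out.1 0)) with hT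
  set ζ := ξ.out.shift T with hζ
  have hζξ : Quotient.mk (asymptoticSetoid X) ζ = ξ :=
    (GeodesicRay.mk_shift _ _).trans (Quotient.out_eq ξ)
  have hball : ∀ n : ℝ≥0, Metric.ball (ζ.1 n) n ⊆ interior (H α₀).carrier := by
    intro n
    refine interior_maximal (fun y hy => ?_) Metric.isOpen_ball
    rw [hα₀]
    change s ≤ busemann ξ x y
    have hy' : dist y (ζ.1 n) < n := hy
    have h1 := hP.busemann_add ξ x (ξ.out.1 0) y
    have h2 := hP.busemann_add ξ (ξ.out.1 0) (ζ.1 n) y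
    have h3 := hP.neg_dist_le_busemann ξ (ζ.1 n) y
    have h4 : busemann ξ (ξ.out.1 0) (ζ.1 n) = T + n := by
      have := hP.busemann_ray ξ.out 0 (T + n)
      rw [Quotient.out_eq] at this
      refine this.trans ?_
      push_cast; ring
    rw [dist_comm] at hy'
    linarith [Real.le_coe_toNNReal (s - busemann ξ x (ξ.out.1 0))]
  obtain ⟨f, hf, hlow, hends⟩ := hX.exists_path_away hbdry hext ζ
  have dζ : ∀ n : ℝ≥0, dist (ζ.1 n) (ζ.1 0) = n := fun n => by
    rw [dist_comm, ζ.dist_of_le zero_le]; simp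
  -- Change of base point from `ζ 0` to `ζ n`: visual estimates for `ζ n` seen from `ζ 0` become
  -- estimates at scale `exp (-n)` for `ζ 0` seen from `ζ n`.
  have hconv : ∀ (n : ℝ≥0) (η : BoundaryAtInfinity X), boundaryVisualDist (ζ.1 n) (ζ.1 0) η *
      boundaryVisualDist (ζ.1 0) (ζ.1 n) η = Real.exp (-n) := by
    intro n η
    have h1 := hP.busemann_add η (ζ.1 0) (ζ.1 n) (ζ.1 0)
    have h2 := hP.busemann_add η (ζ.1 0) (ζ.1 0) (ζ.1 0)
    rw [boundaryVisualDist, boundaryVisualDist, ← Real.exp_add, dist_comm (ζ.1 0), dζ]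
    congr 1; linarith
  have key : ∀ n : ℕ, ∃ σ : GeodesicRay X, 2 ≤ n → σ.1 0 = ζ.1 n ∧
      Real.exp (dist (σ.1 n) (ζ.1 0) / 2) ≤ 1 + 1 / 0.36 ∧
      ∀ α, α ≠ α₀ → ∀ t, σ.1 t ∉ (H α).shrink 1.52 := by
    intro n
    by_cases hn : 2 ≤ n
    swap
    -- A dummy value, since only `n ≥ 2` matters.
    · exact ⟨ζ, fun h => absurd h hn⟩
    have hn2 : (2 : ℝ≥0) ≤ n := by exact_mod_cast hn
    have hn0 : (0 : ℝ) < n := by positivity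
    obtain ⟨t, ht, h⟩ := hX.exists_boundary_avoiding (ζ.1 n) (fun α : {α // α ≠ α₀} => H α.1)
      (fun α β hαβ => hdisj fun h => hαβ (Subtype.ext h)) (R := n)
      (fun α c r hr hc => add_le_dist_of_disjoint_ball hX.geodesic hn0 hr
        ((hdisj α.2.symm).mono (by simpa using hball n) hc)) hf (fun c => by
        -- Seen from `ζ n`, the ends of the path are at distances at least `2 exp (-n)` and at most
        -- `exp (-n) / 0.86` from `ζ 0`, and `2 - 1 / 0.86 > 0.66`.
        have h1 := hP.boundaryVisualDist_le_add (ζ.1 n) (ζ.1 0) c (f 1) (f 0)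
        obtain ⟨h2, h3⟩ := hends n hn2
        have h4 := hconv n (f 0)
        have h5 := hconv n (f 1)
        rw [NNReal.coe_natCast] at h4 h5
        have p0 : 0 < boundaryVisualDist (ζ.1 n) (ζ.1 0) (f 0) := Real.exp_pos _
        have p1 : 0 < boundaryVisualDist (ζ.1 n) (ζ.1 0) (f 1) := Real.exp_pos _
        have h6 := mul_le_mul_of_nonneg_left h2 p0.le
        have h7 := mul_le_mul_of_nonneg_left h3 p1.le
        linarith [Real.exp_pos (-(n : ℝ))])
    obtain ⟨σ, h0, hσ⟩ := hX.exists_ray (f t) (ζ.1 n)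
    refine ⟨σ, fun _ => ⟨h0, ?_, fun α hα u => h σ h0 hσ ⟨α, hα⟩ u⟩⟩
    have hd : nndist (σ.1 0) (ζ.1 0) = n := by
      rw [← NNReal.coe_inj, coe_nndist, h0, dζ]
    have h1 := hP.exp_half_dist_ray_le σ (ζ.1 0)
    rw [hd] at h1
    refine h1.trans (add_le_add_right ?_ _)
    rw [hσ, h0, dζ]
    have h2 := hlow t ht n hn2
    rw [le_div_iff₀ (by norm_num)]
    refine (mul_le_mul_of_nonneg_left h2 (Real.exp_pos _).le).trans (le_of_eq ?_)
    have h3 := hP.busemann_add (f t) (ζ.1 0) (ζ.1 n) (ζ.1 0)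
    have h4 := hP.busemann_add (f t) (ζ.1 0) (ζ.1 0) (ζ.1 0)
    rw [boundaryVisualDist, ← Real.exp_add, dist_comm (ζ.1 0), dζ, Real.exp_eq_one_iff]
    linarith
  choose σ hσ using key
  obtain ⟨γ, hγ, hlim⟩ := hP.exists_limit_line ζ σ
    ((eventually_ge_atTop 2).mono fun n hn => (hσ n hn).1)
    ((eventually_ge_atTop 2).mono fun n hn => (hσ n hn).2.1)
  refine ⟨γ, hγ.trans hζξ, fun α hα t ht => ?_⟩
  -- The radius `0.014` is `1.534 - 1.52`.
  obtain ⟨n, hn1, hn2⟩ := (((eventually_ge_atTop 2).filter_mono Nat.hyperfilter_le_atTop).and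
    ((hlim t).eventually (Metric.closedBall_mem_nhds (γ.1 t) (ε := 0.014) (by norm_num)))).exists
  refine (hσ n hn1).2.2 α hα (Real.toNNReal (n + t)) ((H α).mem_shrink_of_dist_le hP ht ?_)
  rw [dist_comm]
  exact (Metric.mem_closedBall.1 hn2).trans (by norm_num)

end HoroballCase

theorem theorem4p1 {X : Type*} [MetricSpace X] [ProperSpace X] [Nontrivial X]
    (hX : IsCATNegOneSpace X)
    (hbdry : PathConnectedSpace (BoundaryAtInfinity X))
    (hext : HasExtendibleGeodesics X)
    {A : Type*} (H : A → BallOrHoroball X)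
    (hdisj : Pairwise fun α β => Disjoint (interior (H α).carrier) (interior (H β).carrier)) :
    (∀ x : X, x ∉ ⋃ α, (H α).carrier →
      ∃ ρ : GeodesicRay X, ρ.1 0 = x ∧ ∀ (α : A) (t : ℝ≥0), ρ.1 t ∉ (H α).shrink 1.534) ∧
    (∀ (α₀ : A) (ξ : BoundaryAtInfinity X) (x : X) (s : ℝ), H α₀ = .horoball ξ x s →
      ∃ γ : GeodesicLine X, GeodesicLine.start γ = ξ ∧
        ∀ α : A, α ≠ α₀ → ∀ t : ℝ, γ.1 t ∉ (H α).shrink 1.534) :=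
  ⟨hX.exists_ray_avoiding hbdry hext H hdisj, hX.exists_line_avoiding hbdry hext H hdisj⟩
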